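/- **Conventions.** Fix a field $k$. For a continuous function $h:X\to\mathbb R$ on a nonempty compact space put $X_t=h^{-1}(]-\infty,t])$, and let $V_t=H_0(X_t;k)$ (singular homology) for $t<\max h$ and $V_t=0$ for $t\ge\max h$, with the maps $V_s\to V_t$, $s\le t$, induced by the inclusions (zero if $t\ge\max h$). Let $\mathrm{r}_s^t$ be the rank of $V_s\to V_t$, and for $a<b<c<d$ let $\mu([a,b]\times[c,d])=\mathrm r_b^c-\mathrm r_a^c-\mathrm r_b^d+\mathrm r_a^d$. The persistence diagram $D(h)$ is the multiset of points of $\mathbb R^2$ in which $(x,y)$ with $x<y$ has multiplicity $\min\{\mu([a,b]\times[c,d]) : a<x<b<c<y<d\}$, each point of the diagonal has infinite multiplicity, and there are no points below the diagonal. In general, a persistence diagram is a multiset of points of $\mathbb R^2$ that contains each point of the diagonal with infinite multiplicity, no point below the diagonal, and for any $s<t$ only finitely many points $(b,d)$ with $b\le s$, $t\le d$, counted with multiplicity. Write $D\sqcup D'$ for the union of multisets (multiplicities add up), and $\mathrm{pers}_p(D)=\bigl(\sum_{(y_1,y_2)\in D}(y_2-y_1)^p\bigr)^{1/p}\in[0,\infty]$.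 **Lemma (Additivity of diagrams).** Let $\phi:\mathbb R\to\mathbb R$ be continuous and $1$-periodic. Then there is a first point $c\in[0,1]$ at which $\phi$ attains its global maximum. Let $D_1=D(\phi|_{[c,c+1]})$. For every real $R>1$: (a) there is a persistence diagram $D'$ such that $$D(\phi|_{[0,R]})=\Bigl(\bigsqcup_{j=1}^{\lfloor R-1\rfloor}D_1\Bigr)\sqcup D',$$ and $\mathrm{pers}_p(D')\le 2\,\mathrm{pers}_p(D_1)$ for every real $p$ with $2^p\ge 3$ (in particular for every integer $p\ge2$); (b) with $N=\lfloor R-c\rfloor=\max\{n\in\mathbb N : c+n\le R\}$ in place of $\lfloor R-1\rfloor$, there is a persistence diagram $D''$ such that $$D(\phi|_{[0,R]})=\Bigl(\bigsqcup_{j=1}^{N}D_1\Bigr)\sqcup D'',$$ and $\mathrm{pers}_p(D'')\le 2\,\mathrm{pers}_p(D_1)$ for every real $p\ge1$. -/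

import Mathlib

open CategoryTheory
open scoped ENNReal

noncomputable section

namespace Persistence

universe u

/-- A multiset of points of the plane, as its multiplicity function (with values in `ℕ ∪ {∞}`).
The union `D ⊔ D'` of multisets, in which multiplicities add up, is `D + D'`, and the union of `n`
copies of `D` is `n • D`. -/
abbrev PlaneMultiset : Type := ℝ × ℝ → ℕ∞

/-- The defining properties of a persistence diagram (without points at infinity): the points of
the diagonal have infinite multiplicity, there is nothing below the diagonal, and every quadrant
`{(b, d) | b ≤ s, t ≤ d}` with `s < t` holds finitely many points, counted with multiplicity. -/
structure IsPersistenceDiagram (D : PlaneMultiset) : Prop where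
  diagonal : ∀ r : ℝ, D (r, r) = ⊤
  below : ∀ b d : ℝ, d < b → D (b, d) = 0
  ne_top : ∀ b d : ℝ, b < d → D (b, d) ≠ ⊤
  finite_quadrant : ∀ s t : ℝ, s < t → {x : ℝ × ℝ | x.1 ≤ s ∧ t ≤ x.2 ∧ D x ≠ 0}.Finite

/-- The total `p`-persistence `(∑_{(b, d) ∈ D} (d - b) ^ p) ^ (1 / p) ∈ [0, ∞]`, where the sum
takes multiplicities into account (points of the diagonal contribute `0`). -/
def pers (p : ℝ) (D : PlaneMultiset) : ℝ≥0∞ :=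
  (∑' x : ℝ × ℝ, (D x : ℝ≥0∞) * ENNReal.ofReal (x.2 - x.1) ^ p) ^ (1 / p)

/-- A persistence module over the field `k`, indexed by `ℝ`. -/
abbrev PersistenceModule (k : Type u) [Field k] : Type _ := ℝ ⥤ ModuleCat.{u} k

variable {k : Type u} [Field k]

/-- The rank of a linear map. -/
def homRank {A B : ModuleCat.{u} k} (f : A ⟶ B) : ℕ :=
  Module.finrank k (LinearMap.range f.hom)

/-- The rank of the structure map `V s ⟶ V t`, for `s ≤ t`. -/
def rank (V : PersistenceModule k) {s t : ℝ} (h : s ≤ t) : ℕ :=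
  homRank (V.map (homOfLE h))

/-- The rectangle measure of a persistence module: the value on the rectangle `[a, b] × [c, d]`,
where `a < b < c < d`, is the alternating sum of four ranks. -/
def rectMeasure (V : PersistenceModule k) {a b c d : ℝ} (hab : a < b) (hbc : b < c)
    (hcd : c < d) : ℤ :=
  (rank V hbc.le : ℤ) - rank V (hab.trans hbc).le - rank V (hbc.trans hcd).le
    + rank V (hab.trans (hbc.trans hcd)).le

open Classical in
/-- The (undecorated) persistence diagram of a persistence module. A point `(x, y)` above the
diagonal has as its multiplicity the least value of the rectangle measure on the rectangles which
hold `(x, y)` in their interior. The points of the diagonal have infinite multiplicity. -/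
def moduleDiagram (V : PersistenceModule k) : PlaneMultiset := fun q =>
  if q.1 < q.2 then
    ⨅ (a : ℝ) (b : ℝ) (c : ℝ) (d : ℝ) (hax : a < q.1) (hxb : q.1 < b) (hbc : b < c) (hcy : c < q.2)
      (hyd : q.2 < d),
      ((rectMeasure V (hax.trans hxb) hbc (hcy.trans hyd)).toNat : ℕ∞)
  else if q.1 = q.2 then ⊤ else 0

/-- The filtration of a space by the sublevel sets `{x | h x ≤ t}` and their inclusions. -/
def sublevel {X : Type} [TopologicalSpace X] (h : X → ℝ) : ℝ ⥤ TopCat.{0} where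
  obj t := TopCat.of {x : X // h x ≤ t}
  map f := TopCat.ofHom
    ⟨fun x => ⟨x.1, x.2.trans (leOfHom f)⟩, Continuous.subtype_mk continuous_subtype_val _⟩

/-- Singular homology of degree `0` with coefficients in the field `k`. -/
def H0 (k : Type u) [Field k] : TopCat.{0} ⥤ ModuleCat.{u} k :=
  (AlgebraicTopology.singularHomologyFunctor (ModuleCat.{u} k) 0).obj (ModuleCat.of k k)

open Classical in
/-- The persistence module which agrees with `V` at those `t` for which `P t` holds and is zero at
the other ones, where `P` is closed under passing to smaller numbers. -/
def truncate (V : PersistenceModule k) (P : ℝ → Prop) (hP : ∀ s t, s ≤ t → P t → P s) :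
    PersistenceModule k where
  obj t := if P t then V.obj t else ModuleCat.of k PUnit
  map {s t} f :=
    if ht : P t then
      eqToHom (if_pos (hP s t (leOfHom f) ht)) ≫ V.map f ≫ eqToHom (if_pos ht).symm
    else 0
  map_id t := by
    by_cases ht : P t
    · simp [ht]
    · have hz : Limits.IsZero (if P t then V.obj t else ModuleCat.of k PUnit) := by
        rw [if_neg ht]
        exact ModuleCat.isZero_of_subsingleton _
      exact hz.eq_of_src _ _
  map_comp {r s t} f g := by
    by_cases ht : P t
    · have hs : P s := hP s t (leOfHom g) ht
      simp [ht, hs]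
    · simp [ht]

/-- The persistence module of `h : X → ℝ`: it is `H₀ {x | h x ≤ t}` for `t < max h` and `0` for
`t ≥ max h`. (For continuous `h` on a nonempty compact space, `t < max h` says that `t < h x` for
some `x`.) -/
def sublevelModule (k : Type u) [Field k] {X : Type} [TopologicalSpace X] (h : X → ℝ) :
    PersistenceModule k :=
  truncate (sublevel h ⋙ H0 k) (fun t => ∃ x, t < h x)
    (fun _ _ hst ⟨x, hx⟩ => ⟨x, lt_of_le_of_lt hst hx⟩)

/-- The persistence diagram `D(f|[a, b])` of the restriction of `f` to the interval `[a, b]`. -/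
def diagram (k : Type u) [Field k] (f : ℝ → ℝ) (a b : ℝ) : PlaneMultiset :=
  moduleDiagram (sublevelModule k (fun x : Set.Icc a b => f x))

end Persistence

end

/-! ### Rank functions and the reconstruction of ranks from diagrams. -/

noncomputable section

open Filter Topology

namespace Persistence

/-! The diagram depends only on the ranks `r s t` with `s < t`. On an interval, `r s t` counts the
components of `{f ≤ t}` that meet `{f ≤ s}`, and it is zero once `t` reaches the maximum
(`diagram_eq_rankDiagram`). A point `m` of global maximum lies in no `{f ≤ t}` with `t < f m`, so no
component crosses it. Cutting an interval at `m` therefore splits the ranks additively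
(`sublevelRank_Icc_add`), and with them the diagrams (`rankDiagram_add`). Cutting `[0, R]` at `c, c
+ 1, ..., c + N` gives `N` translates of `[c, c + 1]` and two end pieces, `[0, c]` and `[c + N, R]`,
each a translate of a subinterval of `[c, c + 1]`. The end pieces are controlled by monotonicity: a
subinterval has smaller ranks, and smaller ranks force a smaller `∑ (d - b) ^ p` for `p ≥ 1`
(`tsum_rpow_mono`). Indeed `r s t` is the number of diagram points in a quadrant (`tsum_quadrant`),
so `∑ (d - b - ε)₊ = ∫ r (t - ε) t dt` is monotone in `r`, and `y ^ p` is a positive superposition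
of the functions `(y - ε)₊`. So the end pieces have total at most twice that of `D₁`, and `2 ≤ 2 ^
p` gives (b). In (a) at most one more copy of `D₁` joins the remainder, which is why `3 ≤ 2 ^ p` is
asked for. -/

/-- The properties of the ranks `r s t` of the maps `V s ⟶ V t`, for `s < t`, which are needed to
reconstruct them from the persistence diagram. -/
structure IsRankFunction (r : ℝ → ℝ → ℕ) : Prop where
  mono_left : ∀ {s s' t : ℝ}, s ≤ s' → s' < t → r s t ≤ r s' t
  anti_right : ∀ {s t t' : ℝ}, s < t → t ≤ t' → r s t' ≤ r s t
  rect : ∀ {a b c d : ℝ}, a ≤ b → b < c → c ≤ d → r a c + r b d ≤ r b c + r a d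
  zero_left : ∃ m : ℝ, ∀ s t, s ≤ m → s < t → r s t = 0
  zero_right : ∃ M : ℝ, ∀ s t, M ≤ t → r s t = 0
  right_cont_left : ∀ {s t : ℝ}, s < t → ∀ᶠ s' in 𝓝[>] s, r s' t = r s t
  right_cont_right : ∀ {s t : ℝ}, s < t → ∀ᶠ t' in 𝓝[>] t, r s t' = r s t

/-- The value of a rank function on the rectangle `[a, b] × [c, d]`. -/
def rankRect (r : ℝ → ℝ → ℕ) (a b c d : ℝ) : ℤ := (r b c : ℤ) - r a c - r b d + r a d

open Classical in
/-- The persistence diagram of a rank function. -/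
def rankDiagram (r : ℝ → ℝ → ℕ) : PlaneMultiset := fun q =>
  if q.1 < q.2 then
    ⨅ (a : ℝ) (b : ℝ) (c : ℝ) (d : ℝ) (_ : a < q.1) (_ : q.1 < b) (_ : b < c) (_ : c < q.2)
      (_ : q.2 < d), ((rankRect r a b c d).toNat : ℕ∞)
  else if q.1 = q.2 then ⊤ else 0

theorem moduleDiagram_eq_rankDiagram {k : Type*} [Field k] (V : PersistenceModule k)
    (r : ℝ → ℝ → ℕ) (h : ∀ s t (hst : s < t), rank V hst.le = r s t) :
    moduleDiagram V = rankDiagram r := by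
  funext q
  unfold moduleDiagram rankDiagram
  split_ifs with hq hq'
  swap
  · rfl
  swap
  · rfl
  refine iInf_congr fun a => iInf_congr fun b => iInf_congr fun c => iInf_congr fun d =>
    iInf_congr fun h1 => iInf_congr fun h2 => iInf_congr fun h3 => iInf_congr fun h4 =>
    iInf_congr fun h5 => ?_
  rw [rectMeasure, rankRect, h b c h3, h a c ((h1.trans h2).trans h3), h b d (h3.trans (h4.trans h5)),
    h a d ((h1.trans h2).trans (h3.trans (h4.trans h5)))]

namespace IsRankFunction

variable {r r₁ r₂ : ℝ → ℝ → ℕ}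

theorem rankRect_nonneg (hr : IsRankFunction r) {a b c d : ℝ} (hab : a ≤ b) (hbc : b < c)
    (hcd : c ≤ d) : 0 ≤ rankRect r a b c d := by
  have := hr.rect hab hbc hcd
  unfold rankRect
  lia

/-- The measure is additive, and the larger rectangle is the smaller one plus four rectangles around
it, each of measure at least zero. -/
theorem rankRect_mono (hr : IsRankFunction r) {a b c d a' b' c' d' : ℝ} (ha : a ≤ a')
    (hab : a' ≤ b') (hb : b' ≤ b) (hbc : b < c) (hc : c ≤ c') (hcd : c' ≤ d') (hd : d' ≤ d) :
    rankRect r a' b' c' d' ≤ rankRect r a b c d := by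
  have h1 := hr.rankRect_nonneg ha (hab.trans_lt (hb.trans_lt hbc)) (hc.trans (hcd.trans hd))
  have h2 := hr.rankRect_nonneg hb hbc (hc.trans (hcd.trans hd))
  have h3 := hr.rankRect_nonneg hab (hb.trans_lt hbc) hc
  have h4 := hr.rankRect_nonneg hab (hb.trans_lt (hbc.trans_le (hc.trans hcd))) hd
  unfold rankRect at *
  lia

theorem rankDiagram_le (r : ℝ → ℝ → ℕ) {a b c d x y : ℝ} (hax : a < x) (hxb : x < b) (hbc : b < c)
    (hcy : c < y) (hyd : y < d) :
    rankDiagram r (x, y) ≤ ((rankRect r a b c d).toNat : ℕ∞) := by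
  have hxy : x < y := hxb.trans (hbc.trans hcy)
  rw [rankDiagram, if_pos hxy]
  exact iInf₂_le_of_le a b <| iInf₂_le_of_le c d <| iInf₂_le_of_le hax hxb <|
    iInf₂_le_of_le hbc hcy <| iInf_le_of_le hyd le_rfl

/-- The multiplicity of a point is the value of all sufficiently small rectangles around it. -/
theorem exists_rect (hr : IsRankFunction r) {x y : ℝ} (hxy : x < y) :
    ∃ n : ℕ, rankDiagram r (x, y) = n ∧ ∃ a b c d : ℝ, a < x ∧ x < b ∧ b < c ∧ c < y ∧ y < d ∧
      ∀ a' b' c' d', a ≤ a' → a' < x → x < b' → b' ≤ b → c ≤ c' → c' < y → y < d' → d' ≤ d →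
        rankRect r a' b' c' d' = n := by
  classical
  have hex : ∃ n : ℕ, ∃ a b c d : ℝ, a < x ∧ x < b ∧ b < c ∧ c < y ∧ y < d ∧
      rankRect r a b c d = n := by
    obtain ⟨b, hxb, hby⟩ := exists_between hxy
    obtain ⟨c, hbc, hcy⟩ := exists_between hby
    have h0 := hr.rankRect_nonneg (a := x - 1) (d := y + 1) (by linarith) hbc (by linarith)
    exact ⟨(rankRect r (x - 1) b c (y + 1)).toNat, x - 1, b, c, y + 1, by linarith, hxb, hbc, hcy,
      by linarith, by lia⟩
  -- A rectangle of least measure: smaller ones around the point have no larger measure by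
  -- monotonicity, and no smaller one by minimality.
  obtain ⟨a, b, c, d, hax, hxb, hbc, hcy, hyd, hn⟩ := Nat.find_spec hex
  refine ⟨Nat.find hex, le_antisymm ?_ ?_, a, b, c, d, hax, hxb, hbc, hcy, hyd, ?_⟩
  · refine (rankDiagram_le r hax hxb hbc hcy hyd).trans ?_
    rw [hn]
    simp
  · rw [rankDiagram, if_pos hxy]
    refine le_iInf₂ fun a' b' => le_iInf₂ fun c' d' => le_iInf₂ fun h1 h2 => le_iInf₂ fun h3 h4 =>
      le_iInf fun h5 => ?_
    have h0 := hr.rankRect_nonneg (h1.trans h2).le h3 (h4.trans h5).le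
    exact_mod_cast Nat.find_min' hex ⟨a', b', c', d', h1, h2, h3, h4, h5, by lia⟩
  · intro a' b' c' d' h1 h2 h3 h4 h5 h6 h7 h8
    have h9 := hr.rankRect_mono h1 (h2.trans h3).le h4 hbc h5 (h6.trans h7).le h8
    have h0 := hr.rankRect_nonneg (h2.trans h3).le (h4.trans_lt (hbc.trans_le h5)) (h6.trans h7).le
    have := Nat.find_min' hex (m := (rankRect r a' b' c' d').toNat)
      ⟨a', b', c', d', h2, h3, h4.trans_lt (hbc.trans_le h5), h6, h7, by lia⟩
    lia

theorem add (h₁ : IsRankFunction r₁) (h₂ : IsRankFunction r₂) :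
    IsRankFunction (fun s t => r₁ s t + r₂ s t) where
  mono_left h h' := add_le_add (h₁.mono_left h h') (h₂.mono_left h h')
  anti_right h h' := add_le_add (h₁.anti_right h h') (h₂.anti_right h h')
  rect h h' h'' := by
    have := h₁.rect h h' h''
    have := h₂.rect h h' h''
    lia
  zero_left := by
    obtain ⟨m₁, hm₁⟩ := h₁.zero_left
    obtain ⟨m₂, hm₂⟩ := h₂.zero_left
    exact ⟨min m₁ m₂, fun s t hs hst => by
      simp [hm₁ s t (hs.trans (min_le_left _ _)) hst, hm₂ s t (hs.trans (min_le_right _ _)) hst]⟩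
  zero_right := by
    obtain ⟨m₁, hm₁⟩ := h₁.zero_right
    obtain ⟨m₂, hm₂⟩ := h₂.zero_right
    exact ⟨max m₁ m₂, fun s t hs => by
      simp [hm₁ s t ((le_max_left _ _).trans hs), hm₂ s t ((le_max_right _ _).trans hs)]⟩
  right_cont_left h := by
    filter_upwards [h₁.right_cont_left h, h₂.right_cont_left h] with s' e₁ e₂
    rw [e₁, e₂]
  right_cont_right h := by
    filter_upwards [h₁.right_cont_right h, h₂.right_cont_right h] with s' e₁ e₂
    rw [e₁, e₂]

/-- On a common small rectangle all three multiplicities are rectangle measures, and these are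
additive in the rank function. -/
theorem rankDiagram_add (h₁ : IsRankFunction r₁) (h₂ : IsRankFunction r₂) :
    rankDiagram (fun s t => r₁ s t + r₂ s t) = rankDiagram r₁ + rankDiagram r₂ := by
  funext ⟨x, y⟩
  rcases lt_trichotomy x y with hxy | rfl | hxy
  · obtain ⟨n, hn, a, b, c, d, hax, hxb, hbc, hcy, hyd, H⟩ := (h₁.add h₂).exists_rect hxy
    obtain ⟨n₁, hn₁, a₁, b₁, c₁, d₁, hax₁, hxb₁, hbc₁, hcy₁, hyd₁, H₁⟩ := h₁.exists_rect hxy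
    obtain ⟨n₂, hn₂, a₂, b₂, c₂, d₂, hax₂, hxb₂, hbc₂, hcy₂, hyd₂, H₂⟩ := h₂.exists_rect hxy
    set a' := max a (max a₁ a₂)
    set b' := min b (min b₁ b₂)
    set c' := max c (max c₁ c₂)
    set d' := min d (min d₁ d₂)
    have ha : a' < x := max_lt hax (max_lt hax₁ hax₂)
    have hb : x < b' := lt_min hxb (lt_min hxb₁ hxb₂)
    have hc : c' < y := max_lt hcy (max_lt hcy₁ hcy₂)
    have hd : y < d' := lt_min hyd (lt_min hyd₁ hyd₂)
    have e := H a' b' c' d' (by simp [a']) ha hb (by simp [b']) (by simp [c']) hc hd (by simp [d'])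
    have e₁ := H₁ a' b' c' d' (by simp [a']) ha hb (by simp [b']) (by simp [c']) hc hd
      (by simp [d'])
    have e₂ := H₂ a' b' c' d' (by simp [a']) ha hb (by simp [b']) (by simp [c']) hc hd
      (by simp [d'])
    rw [Pi.add_apply, hn, hn₁, hn₂]
    have : n = n₁ + n₂ := by
      simp only [rankRect] at e e₁ e₂
      push_cast at e
      lia
    exact_mod_cast this
  · simp [rankDiagram]
  · simp [rankDiagram, not_lt.2 hxy.le, hxy.ne']

/-- The jumps `r x t - lim_{z → x-} r z t`. -/
theorem exists_jump (hr : IsRankFunction r) (t : ℝ) :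
    ∃ J : ℝ → ℕ, ∀ x < t, ∀ᶠ z in 𝓝[<] x, r x t = r z t + J x := by
  have : ∀ x, ∃ n : ℕ, x < t → ∀ᶠ z in 𝓝[<] x, r x t = r z t + n := by
    intro x
    by_cases hx : x < t
    · have hex : ∃ n : ℕ, ∃ z < x, r x t = r z t + n :=
        ⟨r x t - r (x - 1) t, x - 1, by linarith, by
          have := hr.mono_left (s := x - 1) (by linarith) hx
          lia⟩
      classical
      obtain ⟨z, hz, hn⟩ := Nat.find_spec hex
      refine ⟨Nat.find hex, fun _ => ?_⟩
      filter_upwards [Ioo_mem_nhdsLT hz] with z' hz'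
      have h1 := hr.mono_left hz'.1.le (hz'.2.trans hx)
      have h2 := hr.mono_left hz'.2.le hx
      have h3 := Nat.find_min' hex (m := r x t - r z' t) ⟨z', hz'.2, by lia⟩
      lia
    · exact ⟨0, fun h => absurd h hx⟩
  choose J hJ using this
  exact ⟨J, hJ⟩

end IsRankFunction

/-- An integer valued increasing right continuous function is the sum of its jumps. -/
theorem tsum_jumps_of_monotone {f J : ℝ → ℕ} {m s : ℝ} (hf : MonotoneOn f (Set.Iic s))
    (hm : ∀ x ≤ m, f x = 0)
    (hrc : ∀ x < s, ∀ᶠ x' in 𝓝[>] x, f x' = f x)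
    (hJ : ∀ x ≤ s, ∀ᶠ z in 𝓝[<] x, f x = f z + J x) :
    ∑' x, (Set.Iic s).indicator (fun x => (J x : ℝ≥0∞)) x = f s := by
  generalize hn : f s = n
  induction n using Nat.strong_induction_on generalizing s with
  | _ n ih =>
  have key : ∀ x ≤ s, (∃ z < x, f z = f x) → J x = 0 := by
    rintro x hx ⟨z, hz, hzx⟩
    obtain ⟨w, hw, hw'⟩ := ((hJ x hx).and (Ioo_mem_nhdsLT hz)).exists
    have h1 := hf (show z ∈ Set.Iic s from hz.le.trans hx) (show w ∈ Set.Iic s from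
      hw'.2.le.trans hx) hw'.1.le
    lia
  rcases Nat.eq_zero_or_pos n with rfl | hpos
  · have : ∀ x ≤ s, f x = 0 := fun x hx => by
      have := hf (show x ∈ Set.Iic s from hx) Set.self_mem_Iic hx
      lia
    simp only [Nat.cast_zero, ENNReal.tsum_eq_zero]
    intro x
    by_cases hx : x ≤ s
    · have := key x hx ⟨x - 1, by linarith, by rw [this x hx, this _ (by linarith)]⟩
      simp [this, Set.indicator_apply]
    · simp [hx]
  · let S : Set ℝ := {x | x ≤ s ∧ f x = n}
    have hms : m < s := by
      by_contra! h
      have := hm s h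
      lia
    have hne : S.Nonempty := ⟨s, le_rfl, hn⟩
    have hbdd : BddBelow S := ⟨m, fun x hx => by
      by_contra! h
      have := hm x h.le
      have := hx.2
      lia⟩
    -- The place of the last jump. By right continuity the value `n` is attained at `x₀` itself;
    -- just to the left `f` is constant and smaller, so induction applies there.
    set x₀ := sInf S
    have hx₀s : x₀ ≤ s := csInf_le hbdd ⟨le_rfl, hn⟩
    have habove : ∀ x, x₀ < x → x ≤ s → f x = n := by
      intro x hx hxs
      obtain ⟨y, hy, hyx⟩ := exists_lt_of_csInf_lt hne hx
      have h1 := hf (show y ∈ Set.Iic s from hy.1) (show x ∈ Set.Iic s from hxs) hyx.le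
      have h2 := hf (show x ∈ Set.Iic s from hxs) Set.self_mem_Iic hxs
      have := hy.2
      lia
    have hx₀ : f x₀ = n := by
      rcases hx₀s.lt_or_eq with h | h
      · obtain ⟨y, hy, hy'⟩ := ((hrc x₀ h).and (Ioo_mem_nhdsGT h)).exists
        rw [← hy, habove y hy'.1 hy'.2.le]
      · rw [h, hn]
    have hbelow : ∀ x < x₀, f x < n := by
      intro x hx
      have h1 := hf (show x ∈ Set.Iic s from hx.le.trans hx₀s) (show x₀ ∈ Set.Iic s from hx₀s) hx.le
      refine lt_of_le_of_ne (h1.trans hx₀.le) fun h => ?_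
      exact absurd (csInf_le hbdd (show x ∈ S from ⟨hx.le.trans hx₀s, h⟩)) (not_le.2 hx)
    obtain ⟨l, hl, hlJ⟩ := (mem_nhdsLT_iff_exists_Ioo_subset).1 (hJ x₀ hx₀s)
    obtain ⟨z, hlz, hzx⟩ := exists_between (show l < x₀ from hl)
    have hz : f x₀ = f z + J x₀ := hlJ ⟨hlz, hzx⟩
    have hzs : z ≤ s := hzx.le.trans hx₀s
    have IH := ih (f z) (hbelow z hzx) (s := z) (hf.mono (Set.Iic_subset_Iic.2 hzs))
      (fun x hx => hrc x (hx.trans_le hzs)) (fun x hx => hJ x (hx.trans hzs)) rfl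
    have hsplit : (Set.Iic s).indicator (fun x => (J x : ℝ≥0∞))
        = fun x => (Set.Iic z).indicator (fun x => (J x : ℝ≥0∞)) x
          + (Pi.single x₀ (J x₀ : ℝ≥0∞) : ℝ → ℝ≥0∞) x := by
      funext x
      rcases lt_trichotomy x x₀ with hx | rfl | hx
      · have hxs : x ≤ s := hx.le.trans hx₀s
        rw [Pi.single_eq_of_ne hx.ne, add_zero]
        by_cases hxz : x ≤ z
        · simp [hxs, hxz]
        · rw [not_le] at hxz
          have hl' : f x₀ = f x + J x₀ := hlJ ⟨hlz.trans hxz, hx⟩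
          have := key x hxs ⟨z, hxz, by lia⟩
          simp [this, Set.indicator_apply]
      · simp [hx₀s, hzx]
      · have hxz : ¬ x ≤ z := by linarith
        rw [Pi.single_eq_of_ne hx.ne']
        by_cases hxs : x ≤ s
        · have := key x hxs ⟨x₀, hx, by rw [hx₀, habove x hx hxs]⟩
          simp [this, Set.indicator_apply]
        · simp [hxs, hxz]
    rw [hsplit, ENNReal.tsum_add, IH, tsum_pi_single]
    have : n = f z + J x₀ := by lia
    rw [this]
    push_cast
    rfl

/-- An integer valued decreasing right continuous function is the sum of its jumps. -/
theorem tsum_jumps_of_antitone {f J : ℝ → ℕ} {M t : ℝ} (hf : AntitoneOn f (Set.Ici t))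
    (hM : ∀ x, M ≤ x → f x = 0)
    (hrc : ∀ x, t ≤ x → ∀ᶠ x' in 𝓝[>] x, f x' = f x)
    (hJ : ∀ x, t < x → ∀ᶠ z in 𝓝[<] x, f z = f x + J x) :
    ∑' x, (Set.Ioi t).indicator (fun x => (J x : ℝ≥0∞)) x = f t := by
  generalize hn : f t = n
  induction n using Nat.strong_induction_on generalizing t with
  | _ n ih =>
  have key : ∀ x, t < x → (∃ z, t ≤ z ∧ z < x ∧ f z = f x) → J x = 0 := by
    rintro x hx ⟨z, htz, hz, hzx⟩
    obtain ⟨w, hw, hw'⟩ := ((hJ x hx).and (Ioo_mem_nhdsLT hz)).exists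
    have h1 := hf (show z ∈ Set.Ici t from htz) (show w ∈ Set.Ici t from
      htz.trans hw'.1.le) hw'.1.le
    lia
  rcases Nat.eq_zero_or_pos n with rfl | hpos
  · simp only [Nat.cast_zero, ENNReal.tsum_eq_zero]
    intro x
    by_cases hx : t < x
    · have h1 := hf Set.self_mem_Ici (show x ∈ Set.Ici t from hx.le) hx.le
      have := key x hx ⟨t, le_rfl, hx, by lia⟩
      simp [this, Set.indicator_apply]
    · simp [hx]
  · let S : Set ℝ := {x | t ≤ x ∧ f x = n}
    have hne : S.Nonempty := ⟨t, le_rfl, hn⟩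
    have hbdd : BddAbove S := ⟨M, fun x hx => by
      by_contra! h
      have := hM x h.le
      have := hx.2
      lia⟩
    -- The first jump after `t`. Here right continuity says that `n` is not attained at `y₀`, so
    -- induction applies at `y₀` itself.
    set y₀ := sSup S
    have hbelow : ∀ x, t ≤ x → x < y₀ → f x = n := by
      intro x htx hx
      obtain ⟨y, hy, hyx⟩ := exists_lt_of_lt_csSup hne hx
      have h1 := hf (show x ∈ Set.Ici t from htx) (show y ∈ Set.Ici t from hy.1) hyx.le
      have h2 := hf Set.self_mem_Ici (show x ∈ Set.Ici t from htx) htx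
      have := hy.2
      lia
    have hno : ∀ x, y₀ < x → f x ≠ n := by
      intro x hx h
      have htx : t ≤ x := (le_csSup hbdd (show t ∈ S from ⟨le_rfl, hn⟩)).trans hx.le
      exact absurd (le_csSup hbdd (show x ∈ S from ⟨htx, h⟩)) (not_le.2 hx)
    have hty : t ≤ y₀ := le_csSup hbdd ⟨le_rfl, hn⟩
    have hy₀ : f y₀ ≠ n := by
      intro h
      obtain ⟨y, hy, hy'⟩ := ((hrc y₀ hty).and self_mem_nhdsWithin).exists
      exact hno y hy' (hy.trans h)
    have hty' : t < y₀ := lt_of_le_of_ne hty (by rintro h; exact hy₀ (h ▸ hn))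
    have hlt : f y₀ < n := lt_of_le_of_ne
      (hn ▸ hf Set.self_mem_Ici (show y₀ ∈ Set.Ici t from hty) hty) hy₀
    have IH := ih (f y₀) hlt (t := y₀) (hf.mono (Set.Ici_subset_Ici.2 hty))
      (fun x hx => hrc x (hty.trans hx)) (fun x hx => hJ x (hty.trans_lt hx)) rfl
    have hsplit : (Set.Ioi t).indicator (fun x => (J x : ℝ≥0∞))
        = fun x => (Set.Ioi y₀).indicator (fun x => (J x : ℝ≥0∞)) x
          + (Pi.single y₀ (J y₀ : ℝ≥0∞) : ℝ → ℝ≥0∞) x := by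
      funext x
      rcases lt_trichotomy x y₀ with hx | rfl | hx
      · rw [Pi.single_eq_of_ne hx.ne, add_zero]
        by_cases htx : t < x
        · have := key x htx ⟨t, le_rfl, htx, by rw [hn, hbelow x htx.le hx]⟩
          simp [this, Set.indicator_apply]
        · simp [htx, hx.le]
      · simp [hty']
      · simp [Pi.single_eq_of_ne hx.ne', hty'.trans hx, hx]
    rw [hsplit, ENNReal.tsum_add, IH, tsum_pi_single]
    obtain ⟨z, hz, hz'⟩ := ((hJ y₀ hty').and (Ioo_mem_nhdsLT hty')).exists
    rw [hbelow z hz'.1.le hz'.2] at hz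
    rw [hz]
    push_cast
    rfl

namespace IsRankFunction

variable {r r₁ r₂ : ℝ → ℝ → ℕ}

/-- The rank `r s t` is the number of points of the diagram in the quadrant
`(-∞, s] × (t, ∞)`. -/
theorem tsum_quadrant (hr : IsRankFunction r) {s t : ℝ} (hst : s < t) :
    ∑' x : ℝ × ℝ, {x : ℝ × ℝ | x.1 ≤ s ∧ t < x.2}.indicator
      (fun x => (rankDiagram r x : ℝ≥0∞)) x = r s t := by
  choose J hJ using fun t => hr.exists_jump t
  have hD : ∀ x y : ℝ, ∃ n : ℕ, x < y → rankDiagram r (x, y) = n := fun x y => by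
    by_cases h : x < y
    · obtain ⟨n, hn, -⟩ := hr.exists_rect h
      exact ⟨n, fun _ => hn⟩
    · exact ⟨0, fun h' => absurd h' h⟩
  choose D hD using hD
  -- `J y x` will count the points on the vertical ray above `(x, y)`; its own jump at `y` is the
  -- multiplicity of `(x, y)`.
  have hJD : ∀ x y, x < y → ∀ᶠ c in 𝓝[<] y, J c x = J y x + D x y := by
    intro x y hxy
    obtain ⟨n, hn, a, b, c, d, hax, hxb, hbc, hcy, hyd, H⟩ := hr.exists_rect hxy
    have hnD : n = D x y := by
      rw [hD x y hxy] at hn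
      exact_mod_cast hn.symm
    filter_upwards [Ioo_mem_nhdsLT hcy] with c' hc'
    have hxc' : x < c' := hxb.trans (hbc.trans hc'.1)
    -- In the small rectangle `[z, w] × [c', e]`, right continuity allows `w` to be replaced by `x`
    -- and `e` by `y`, which leaves a difference of two jumps at `x`.
    obtain ⟨z, ⟨hz1, hz2⟩, hz⟩ :=
      (((hJ c' x hxc').and (hJ y x hxy)).and (Ioo_mem_nhdsLT hax)).exists
    obtain ⟨e, ⟨he1, he2⟩, he⟩ := (((hr.right_cont_right hxy).and
      (hr.right_cont_right (hz.2.trans hxy))).and (Ioo_mem_nhdsGT hyd)).exists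
    obtain ⟨w, ⟨hw1, hw2⟩, hw⟩ := (((hr.right_cont_left hxc').and
      (hr.right_cont_left (hxy.trans he.1))).and (Ioo_mem_nhdsGT hxb)).exists
    have := H z w c' e hz.1.le hz.2 hw.1 hw.2.le hc'.1.le hc'.2 he.1 he.2.le
    unfold rankRect at this
    lia
  obtain ⟨M, hM⟩ := hr.zero_right
  have h1 : ∀ x ≤ s, ∑' y, (Set.Ioi t).indicator (fun y => (D x y : ℝ≥0∞)) y = J t x := by
    intro x hx
    have hxt := hx.trans_lt hst
    have hanti : ∀ y y', x < y → y ≤ y' → J y' x ≤ J y x := by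
      intro y y' hy hyy'
      obtain ⟨z, ⟨hz1, hz2⟩, hz⟩ := (((hJ y x hy).and (hJ y' x (hy.trans_le hyy'))).and
        self_mem_nhdsWithin).exists
      have := hr.rect (le_of_lt hz) hy hyy'
      lia
    -- The bound `x + 1` keeps `x < y`, the range in which `J y x` is specified.
    refine tsum_jumps_of_antitone (f := fun y => J y x) (M := max M (x + 1)) ?_ ?_ ?_ ?_
    · intro y hy y' hy' hyy'
      exact hanti y y' (hxt.trans_le hy) hyy'
    · intro y hy
      have hxy : x < y := by
        have := (le_max_right _ _).trans hy
        linarith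
      obtain ⟨z, hz⟩ := (hJ y x hxy).exists
      rw [hM x y ((le_max_left _ _).trans hy)] at hz
      lia
    · intro y hy
      have hxy := hxt.trans_le hy
      filter_upwards [hr.right_cont_right hxy, self_mem_nhdsWithin] with y' h1 h3
      obtain ⟨w, ⟨hw, hwy⟩, hw'⟩ := (((hJ y' x (hxy.trans h3)).and (hJ y x hxy)).and
        self_mem_nhdsWithin).exists
      have h4 := hr.anti_right (lt_trans hw' hxy) (le_of_lt h3)
      have h5 := hanti y y' hxy (le_of_lt h3)
      lia
    · intro y hy
      exact hJD x y (hxt.trans hy)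
  obtain ⟨m, hm⟩ := hr.zero_left
  have h2 : ∑' x, (Set.Iic s).indicator (fun x => (J t x : ℝ≥0∞)) x = r s t := by
    refine tsum_jumps_of_monotone (f := fun x => r x t) (m := min m s) ?_ ?_ ?_ ?_
    · intro x hx x' hx' hxx'
      exact hr.mono_left hxx' (lt_of_le_of_lt hx' hst)
    · intro x hx
      exact hm x t (hx.trans (min_le_left _ _)) ((hx.trans (min_le_right _ _)).trans_lt hst)
    · intro x hx
      exact hr.right_cont_left (hx.trans hst)
    · intro x hx
      exact hJ t x (hx.trans_lt hst)
  rw [← h2, ENNReal.tsum_prod']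
  refine tsum_congr fun x => ?_
  by_cases hx : x ≤ s
  · rw [Set.indicator_of_mem (show x ∈ Set.Iic s from hx), ← h1 x hx]
    refine tsum_congr fun y => ?_
    by_cases hy : t < y
    · simp [hx, hy, hD x y (hx.trans_lt (hst.trans hy))]
    · simp [hy]
  · simp [hx]

theorem isPersistenceDiagram (hr : IsRankFunction r) : IsPersistenceDiagram (rankDiagram r) where
  diagonal x := by simp [rankDiagram]
  below b d h := by simp [rankDiagram, not_lt.2 h.le, h.ne']
  ne_top b d h := by
    obtain ⟨n, hn, -⟩ := hr.exists_rect h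
    simp [hn]
  finite_quadrant s t hst := by
    -- The quadrant counted by `r s u` is open at `u`, so `u < t` makes it contain the closed one.
    obtain ⟨u, hsu, hut⟩ := exists_between hst
    have h1 := hr.tsum_quadrant hsu
    refine (ENNReal.finite_const_le_of_tsum_ne_top (ε := 1) (h1 ▸ ENNReal.natCast_ne_top _)
      one_ne_zero).subset ?_
    rintro x ⟨hx1, hx2, hx3⟩
    have hx : x ∈ {x : ℝ × ℝ | x.1 ≤ s ∧ u < x.2} := ⟨hx1, hut.trans_le hx2⟩
    rw [Set.mem_ofPred_eq, Set.indicator_of_mem hx]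
    exact_mod_cast Order.one_le_iff_pos.2 (pos_iff_ne_zero.2 hx3)

end IsRankFunction

theorem IsPersistenceDiagram.add {D₁ D₂ : PlaneMultiset} (h₁ : IsPersistenceDiagram D₁)
    (h₂ : IsPersistenceDiagram D₂) : IsPersistenceDiagram (D₁ + D₂) where
  diagonal x := by simp [h₁.diagonal]
  below b d h := by simp [h₁.below b d h, h₂.below b d h]
  ne_top b d h := by simp [h₁.ne_top b d h, h₂.ne_top b d h]
  finite_quadrant s t h := by
    refine ((h₁.finite_quadrant s t h).union (h₂.finite_quadrant s t h)).subset ?_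
    rintro x ⟨hx1, hx2, hx3⟩
    by_cases h0 : D₁ x = 0
    · exact Or.inr ⟨hx1, hx2, fun h => hx3 (by simp [h0, h])⟩
    · exact Or.inl ⟨hx1, hx2, h0⟩

end Persistence

end

/-! ### Ranks in singular homology of degree zero. -/

noncomputable section

open Limits AlgebraicTopology

namespace Persistence

universe u
variable {k : Type u} [Field k]

theorem homRank_iso_comp {A B C D : ModuleCat.{u} k} (e : A ≅ B) (f : B ⟶ C) (e' : C ≅ D) :
    homRank (e.hom ≫ f ≫ e'.hom) = homRank f := by
  unfold homRank
  have h : (e.hom ≫ f ≫ e'.hom).hom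
      = e'.toLinearEquiv.toLinearMap ∘ₗ f.hom ∘ₗ e.toLinearEquiv.toLinearMap := rfl
  rw [h, LinearMap.range_comp, LinearMap.range_comp_of_range_eq_top _ (LinearEquiv.range _)]
  exact LinearEquiv.finrank_map_eq e'.toLinearEquiv _

theorem homRank_zero (A B : ModuleCat.{u} k) : homRank (0 : A ⟶ B) = 0 := by
  unfold homRank
  rw [ModuleCat.hom_zero, LinearMap.range_zero, finrank_bot]

theorem rank_truncate_of_pos (V : PersistenceModule k) {P : ℝ → Prop}
    (hP : ∀ s t, s ≤ t → P t → P s) {s t : ℝ} (hst : s ≤ t) (ht : P t) :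
    rank (truncate V P hP) hst = rank V hst := by
  unfold rank truncate
  simp only [ht, dite_true]
  exact homRank_iso_comp (eqToIso (if_pos (hP s t hst ht))) _ (eqToIso (if_pos ht).symm)

theorem rank_truncate_of_neg (V : PersistenceModule k) {P : ℝ → Prop}
    (hP : ∀ s t, s ≤ t → P t → P s) {s t : ℝ} (hst : s ≤ t) (ht : ¬ P t) :
    rank (truncate V P hP) hst = 0 := by
  unfold rank truncate
  simp only [ht, dite_false]
  exact homRank_zero _ _

variable {ι κ : Type}

/-- The basis vectors of a coproduct of copies of the field. -/
def coprodBasis (k : Type u) [Field k] (i : ι) : (∐ fun _ : ι => ModuleCat.of k k : ModuleCat.{u} k) :=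
  (Sigma.ι (fun _ : ι => ModuleCat.of k k) i).hom (1 : k)

theorem linearIndependent_coprodBasis (ι : Type) :
    LinearIndependent k (coprodBasis k : ι → _) := by
  classical
  rw [linearIndependent_iff']
  intro s g hg i hi
  let p : (∐ fun _ : ι => ModuleCat.of k k : ModuleCat.{u} k) ⟶ ModuleCat.of k k :=
    Sigma.desc fun j => if j = i then 𝟙 _ else 0
  have hp : ∀ j, p.hom (coprodBasis k j) = if j = i then (1 : k) else 0 := by
    intro j
    have h : Sigma.ι (fun _ : ι => ModuleCat.of k k) j ≫ p = if j = i then 𝟙 _ else 0 :=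
      Sigma.ι_desc _ _
    have h' := congrArg (fun q => q.hom (1 : k)) h
    refine Eq.trans h' ?_
    split_ifs <;> rfl
  have := congrArg p.hom hg
  simpa [hp, hi] using this

theorem span_coprodBasis (ι : Type) :
    Submodule.span k (Set.range (coprodBasis k : ι → _)) = ⊤ := by
  set S := Submodule.span k (Set.range (coprodBasis k : ι → _))
  -- Maps out of a coproduct are determined on the summands, and the quotient map by the span kills
  -- each of them.
  have h : ModuleCat.ofHom S.mkQ = 0 := by
    refine Sigma.hom_ext _ _ fun i => ?_
    refine ModuleCat.hom_ext (LinearMap.ext_ring ?_)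
    change S.mkQ (coprodBasis k i) = 0
    simpa using Submodule.subset_span (Set.mem_range_self i)
  rw [← S.ker_mkQ]
  exact LinearMap.ker_eq_top.2 (congrArg ModuleCat.Hom.hom h)

/-- The rank of the map which is induced on coproducts of copies of the field. -/
theorem homRank_of_map_coprodBasis (g : ι → κ)
    (f : (∐ fun _ : ι => ModuleCat.of k k : ModuleCat.{u} k) ⟶ (∐ fun _ : κ => ModuleCat.of k k))
    (hf : ∀ i, Sigma.ι (fun _ : ι => ModuleCat.of k k) i ≫ f
      = Sigma.ι (fun _ : κ => ModuleCat.of k k) (g i)) :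
    homRank f = (Set.range g).ncard := by
  have hf' : ∀ i, f.hom (coprodBasis k i) = coprodBasis k (g i) := fun i =>
    congrArg (fun q => q.hom (1 : k)) (hf i)
  have h : LinearMap.range f.hom
      = Submodule.span k (Set.range fun j : Set.range g => coprodBasis k j.1) := by
    rw [LinearMap.range_eq_map, ← span_coprodBasis, Submodule.map_span, ← Set.range_comp]
    congr 1
    ext v
    simp [hf']
  have hli : LinearIndependent k (fun j : Set.range g => coprodBasis k j.1) :=
    (linearIndependent_coprodBasis κ).comp _ Subtype.val_injective
  unfold homRank
  rw [h, Module.finrank, rank_span hli]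
  exact Set.ncard_range_of_injective hli.injective

variable {X Y : TopCat.{0}}

/-- The class of a point in singular homology. -/
def pointClass (k : Type u) [Field k] (x : X) :
    ModuleCat.of k k ⟶ (TopCat.toSSet.obj X).homology (ModuleCat.of k k) 0 :=
  ((TopCat.toSSet.obj X).chainComplex (ModuleCat.of k k)).liftCycles
      (k := (TopCat.toSSet.obj X).ιChainComplex (TopCat.toSSetObj₀Equiv.symm x)) 0
      (by simp) (by simp) ≫
    ((TopCat.toSSet.obj X).chainComplex (ModuleCat.of k k)).homologyπ 0

theorem pointClass_naturality (f : X ⟶ Y) (x : X) :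
    pointClass k x ≫ SSet.homologyMap (TopCat.toSSet.map f) (ModuleCat.of k k) 0
      = pointClass k (f x) := by
  unfold pointClass
  rw [Category.assoc, HomologicalComplex.homologyπ_naturality, ← Category.assoc,
    HomologicalComplex.liftCycles_comp_cyclesMap]
  congr 1
  rw [← cancel_mono (HomologicalComplex.iCycles _ _), HomologicalComplex.liftCycles_i,
    HomologicalComplex.liftCycles_i, SSet.ι_chainComplexMap_f]
  rfl

/-- Singular homology in degree `0` is free on the path components. -/
def homologyZeroIso (k : Type u) [Field k] (X : TopCat.{0}) :
    (TopCat.toSSet.obj X).homology (ModuleCat.of k k) 0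
      ≅ ∐ fun _ : ZerothHomotopy X => ModuleCat.of k k :=
  (TopCat.toSSet.obj X).homology₀Iso (ModuleCat.of k k) ≪≫
    (sigmaConst.obj (ModuleCat.of k k)).mapIso TopCat.zerothHomotopyEquiv.toIso.symm

theorem pointClass_comp_iso (x : X) :
    pointClass k x ≫ (homologyZeroIso k X).hom
      = Sigma.ι (fun _ : ZerothHomotopy X => ModuleCat.of k k) (.mk x) := by
  have h := SSet.liftCycles_ιChainComplex_homologyπ_homology₀Iso_hom_assoc
    (TopCat.toSSet.obj X) (ModuleCat.of k k) (TopCat.toSSetObj₀Equiv.symm x)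
    ((sigmaConst.obj (ModuleCat.of k k)).mapIso TopCat.zerothHomotopyEquiv.toIso.symm).hom
  unfold pointClass homologyZeroIso
  rw [Iso.trans_hom, Category.assoc]
  refine h.trans ?_
  rw [Functor.mapIso_hom]
  refine (Sigma.ι_comp_map' _ _ _).trans ?_
  rw [Category.id_comp]
  congr 1

/-- Point classes are natural and correspond to the basis vectors indexed by path components, so the
map sends basis vectors to basis vectors. -/
theorem homRank_homologyMap (f : X ⟶ Y) :
    homRank (SSet.homologyMap (TopCat.toSSet.map f) (ModuleCat.of k k) 0)
      = (Set.range fun x : X => (ZerothHomotopy.mk (f x))).ncard := by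
  let g : ZerothHomotopy X → ZerothHomotopy Y := ZerothHomotopy.lift (fun x => .mk (f x))
    fun _ _ p => ZerothHomotopy.sound (p.map f.hom.continuous)
  have hinv (Z : TopCat.{0}) (z : Z) :
      Sigma.ι (fun _ : ZerothHomotopy Z => ModuleCat.of k k) (.mk z) ≫ (homologyZeroIso k Z).inv
        = pointClass k z := by
    rw [Iso.comp_inv_eq, pointClass_comp_iso]
  rw [← homRank_iso_comp (homologyZeroIso k X).symm _ (homologyZeroIso k Y),
    homRank_of_map_coprodBasis g]
  · congr 1
    ext y
    constructor
    · rintro ⟨x, rfl⟩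
      obtain ⟨x, rfl⟩ := x.mk_surjective
      exact ⟨x, rfl⟩
    · rintro ⟨x, rfl⟩
      exact ⟨.mk x, rfl⟩
  · intro x
    obtain ⟨x, rfl⟩ := x.mk_surjective
    rw [Iso.symm_hom, ← Category.assoc, hinv, ← Category.assoc, pointClass_naturality,
      pointClass_comp_iso]
    rfl

/-- The rank of a map in singular homology of degree `0` is the number of path components
of the target which meet the image. -/
theorem homRank_H0_map (f : X ⟶ Y) :
    homRank ((H0 k).map f) = (Set.range fun x : X => (ZerothHomotopy.mk (f x))).ncard :=
  homRank_homologyMap f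

end Persistence

end

/-! ### Sublevel components of functions on the line. -/

noncomputable section

open Filter Topology

namespace Persistence

/-- The points which are joined to `x` by an interval on which `f` is at most `t`. -/
def sublevelClass (f : ℝ → ℝ) (t x : ℝ) : Set ℝ := {y | ∀ z ∈ Set.uIcc x y, f z ≤ t}

/-- The components of `{f ≤ t}` which hold a point of `A` at which `f` is at most `s`. -/
def sublevelClasses (f : ℝ → ℝ) (A : Set ℝ) (s t : ℝ) : Set (Set ℝ) :=
  sublevelClass f t '' {x ∈ A | f x ≤ s}

open Classical in
/-- The number of components of `{f ≤ t}` which hold a point of `A` at which `f` is at most `s`,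
or zero for `t ≥ max f|A`. -/
def sublevelRank (f : ℝ → ℝ) (A : Set ℝ) (s t : ℝ) : ℕ :=
  if ∃ x ∈ A, t < f x then (sublevelClasses f A s t).ncard else 0

variable {f : ℝ → ℝ} {A B : Set ℝ} {s t : ℝ}

theorem sublevelClass_eq_iff {x y : ℝ} (hy : f y ≤ t) :
    sublevelClass f t x = sublevelClass f t y ↔ ∀ z ∈ Set.uIcc x y, f z ≤ t := by
  constructor
  · intro h
    have : y ∈ sublevelClass f t y := by
      intro z hz
      rw [Set.uIcc_self, Set.mem_singleton_iff] at hz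
      rwa [hz]
    rwa [← h] at this
  · intro h
    ext w
    constructor
    · intro hw z hz
      rcases Set.uIcc_subset_uIcc_union_uIcc (b := x) hz with hz | hz
      · exact h z (Set.uIcc_comm y x ▸ hz)
      · exact hw z hz
    · intro hw z hz
      rcases Set.uIcc_subset_uIcc_union_uIcc (b := y) hz with hz | hz
      · exact h z hz
      · exact hw z hz

theorem sublevelClass_congr {t' x y : ℝ} (htt' : t ≤ t') (hy : f y ≤ t)
    (h : sublevelClass f t x = sublevelClass f t y) :
    sublevelClass f t' x = sublevelClass f t' y :=
  (sublevelClass_eq_iff (hy.trans htt')).2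
    fun z hz => ((sublevelClass_eq_iff hy).1 h z hz).trans htt'

/-- The gap `s < t` leaves room: near a point with `f x ≤ s` the function stays below `t`. On a
compact set this makes the number of classes finite. -/
theorem isLocallyConstant_sublevelClass (hf : Continuous f) (hst : s < t) :
    IsLocallyConstant fun x : {x ∈ A | f x ≤ s} => sublevelClass f t x := by
  rw [IsLocallyConstant.iff_eventually_eq]
  rintro ⟨x, hxA, hx⟩
  have h : ∀ᶠ y in 𝓝 x, f y < t := hf.continuousAt.eventually_lt_const (hx.trans_lt hst)
  obtain ⟨ε, hε, hball⟩ := Metric.eventually_nhds_iff_ball.1 h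
  have hx' : ∀ᶠ y in 𝓝 x, y ∈ Metric.ball x ε := Metric.ball_mem_nhds x hε
  filter_upwards [continuous_subtype_val.continuousAt.eventually hx'] with y hy
  refine (sublevelClass_eq_iff (hx.trans hst.le)).2 fun z hz => (hball z ?_).le
  exact (convex_ball x ε).ordConnected.uIcc_subset hy (Metric.mem_ball_self hε) hz

theorem finite_sublevelClasses (hf : Continuous f) (hA : IsCompact A) (hst : s < t) :
    (sublevelClasses f A s t).Finite := by
  have hK : IsCompact {x ∈ A | f x ≤ s} :=
    hA.inter_right (isClosed_le hf continuous_const)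
  have := isCompact_iff_compactSpace.1 hK
  have h := (isLocallyConstant_sublevelClass (A := A) hf hst).range_finite
  rwa [Set.range_comp' (sublevelClass f t) Subtype.val, Subtype.range_coe] at h

theorem sublevelClasses_mono {s' : ℝ} (hAB : A ⊆ B) (hss' : s ≤ s') :
    sublevelClasses f A s t ⊆ sublevelClasses f B s' t :=
  Set.image_mono fun _ hx => ⟨hAB hx.1, hx.2.trans hss'⟩

/-- The map which sends a component of `{f ≤ t}` to the component of `{f ≤ t'}` around it. -/
theorem exists_sublevelClass_map {t' : ℝ} (htt' : t ≤ t') :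
    ∃ g : Set ℝ → Set ℝ, ∀ x, f x ≤ t → g (sublevelClass f t x) = sublevelClass f t' x := by
  classical
  refine ⟨fun C => if h : ∃ x, f x ≤ t ∧ sublevelClass f t x = C then
    sublevelClass f t' h.choose else ∅, fun x hx => ?_⟩
  have h : ∃ y, f y ≤ t ∧ sublevelClass f t y = sublevelClass f t x := ⟨x, hx, rfl⟩
  exact (dif_pos h).trans (sublevelClass_congr htt' hx h.choose_spec.2)

theorem isRankFunction_sublevelRank (hf : Continuous f) (hA : IsCompact A) :
    IsRankFunction (sublevelRank f A) := by
  have hfin : ∀ {s t}, s < t → (sublevelClasses f A s t).Finite := finite_sublevelClasses hf hA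
  have hmono : ∀ {s s' t : ℝ}, s ≤ s' → s' < t →
      (sublevelClasses f A s t).ncard ≤ (sublevelClasses f A s' t).ncard := fun h h' =>
    Set.ncard_le_ncard (sublevelClasses_mono subset_rfl h) (hfin h')
  have hanti : ∀ {s t t' : ℝ}, s < t → t ≤ t' →
      (sublevelClasses f A s t').ncard ≤ (sublevelClasses f A s t).ncard := by
    intro s t t' hst htt'
    obtain ⟨g, hg⟩ := exists_sublevelClass_map (f := f) htt'
    have : sublevelClasses f A s t' = g '' sublevelClasses f A s t := by
      rw [sublevelClasses, sublevelClasses, Set.image_image]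
      exact Set.image_congr fun x hx => (hg x (hx.2.trans hst.le)).symm
    rw [this]
    exact Set.ncard_image_le (hfin hst)
  refine ⟨?_, ?_, ?_, ?_, ?_, ?_, ?_⟩
  · intro s s' t h h'
    unfold sublevelRank
    split_ifs
    · exact hmono h h'
    · exact le_rfl
  · intro s t t' hst htt'
    unfold sublevelRank
    split_ifs with h h'
    · exact hanti hst htt'
    · obtain ⟨x, hx, hxt⟩ := h
      exact absurd ⟨x, hx, htt'.trans_lt hxt⟩ h'
    · exact Nat.zero_le _
    · exact le_rfl
  · intro a b c d hab hbc hcd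
    unfold sublevelRank
    split_ifs with h1 h2 h2
    · obtain ⟨g, hg⟩ := exists_sublevelClass_map (f := f) hcd
      have h3 := Set.ncard_sdiff_add_ncard_of_subset
        (sublevelClasses_mono (f := f) (t := c) (subset_refl A) hab) (hfin hbc)
      have h4 := Set.ncard_sdiff_add_ncard_of_subset
        (sublevelClasses_mono (f := f) (t := d) (subset_refl A) hab) (hfin (hbc.trans_le hcd))
      -- A class at level `d` that is met by `{f ≤ b}` but not by `{f ≤ a}` comes from such a class
      -- at level `c`.
      have h5 : sublevelClasses f A b d \ sublevelClasses f A a d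
          ⊆ g '' (sublevelClasses f A b c \ sublevelClasses f A a c) := by
        rintro _ ⟨⟨x, hx, rfl⟩, hx'⟩
        refine ⟨sublevelClass f c x, ⟨⟨x, hx, rfl⟩, ?_⟩, hg x (hx.2.trans hbc.le)⟩
        rintro ⟨y, hy, hyx⟩
        exact hx' ⟨y, hy, sublevelClass_congr hcd (hx.2.trans hbc.le) hyx⟩
      have h6 := Set.ncard_le_ncard h5 ((hfin hbc).sdiff.image g)
      have h7 := Set.ncard_image_le (f := g) ((hfin hbc).sdiff (t := sublevelClasses f A a c))
      lia
    · simpa using hmono hab hbc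
    · obtain ⟨x, hx, hxt⟩ := h2
      exact absurd ⟨x, hx, hcd.trans_lt hxt⟩ h1
    · exact le_rfl
  · obtain ⟨m, hm⟩ := (hA.image hf).bddBelow
    refine ⟨m - 1, fun s t hs _ => ?_⟩
    have : sublevelClasses f A s t = ∅ := by
      rw [sublevelClasses, Set.image_eq_empty, Set.eq_empty_iff_forall_notMem]
      rintro x ⟨hx, hxs⟩
      have := hm (Set.mem_image_of_mem f hx)
      linarith
    simp [sublevelRank, this]
  · obtain ⟨M, hM⟩ := (hA.image hf).bddAbove
    refine ⟨M, fun s t ht => if_neg ?_⟩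
    rintro ⟨x, hx, hxt⟩
    exact absurd (hM (Set.mem_image_of_mem f hx)) (not_le.2 (ht.trans_lt hxt))
  · intro s t hst
    obtain ⟨s₀, hss₀, hs₀t⟩ := exists_between hst
    have hK : IsCompact {x ∈ A | f x ≤ s₀} := hA.inter_right (isClosed_le hf continuous_const)
    have := isCompact_iff_compactSpace.1 hK
    have hloc := isLocallyConstant_sublevelClass (A := A) hf hs₀t
    have key : ∀ C ∈ sublevelClasses f A s₀ t, ∀ᶠ s' in 𝓝[>] s,
        C ∈ sublevelClasses f A s' t → C ∈ sublevelClasses f A s t := by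
      rintro _ ⟨x, hx, rfl⟩
      by_cases hC : sublevelClass f t x ∈ sublevelClasses f A s t
      · exact Eventually.of_forall fun _ _ => hC
      have hcl : IsClosed {y : {x ∈ A | f x ≤ s₀} | sublevelClass f t y = sublevelClass f t x} :=
        hloc.isClosed_fiber _
      -- If a class holds no point of `A` with `f ≤ s`, the minimum of `f` on its compact part in
      -- `A` exceeds `s`, so the class is still missed for `s'` slightly above `s`.
      obtain ⟨y, hy, hymin⟩ := hcl.isCompact.exists_isMinOn ⟨⟨x, hx⟩, rfl⟩
        (hf.comp continuous_subtype_val).continuousOn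
      have hys : s < f y := by
        by_contra! h
        exact hC ⟨y, ⟨y.2.1, h⟩, hy⟩
      filter_upwards [Ioo_mem_nhdsGT hys, Ioo_mem_nhdsGT hss₀] with s' h1 h2
      rintro ⟨z, hz, hzx⟩
      have h3 := hymin (show (⟨z, hz.1, hz.2.trans h2.2.le⟩ : {x ∈ A | f x ≤ s₀}) ∈ _ from hzx)
      exact absurd (h1.2.trans_le (le_trans h3 hz.2)) (lt_irrefl _)
    filter_upwards [(eventually_all_finite (hfin hs₀t)).2 key, Ioo_mem_nhdsGT hss₀] with s' h1 h2
    have : sublevelClasses f A s' t = sublevelClasses f A s t := by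
      refine Set.Subset.antisymm (fun C hC => ?_) (sublevelClasses_mono subset_rfl h2.1.le)
      exact h1 C (sublevelClasses_mono subset_rfl h2.2.le hC) hC
    rw [sublevelRank, sublevelRank, this]
  · intro s t hst
    by_cases ht : ∃ x ∈ A, t < f x
    · obtain ⟨F, hFs, hF⟩ := Set.SurjOn.exists_bijOn_subset
        (Set.surjOn_image (sublevelClass f t) {x ∈ A | f x ≤ s})
      have hFfin : F.Finite := hF.finite_iff_finite.2 (hfin hst)
      have key : ∀ x ∈ F, ∀ᶠ t' in 𝓝[>] t, ∀ y ∈ F,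
          sublevelClass f t' x = sublevelClass f t' y → x = y := by
        intro x hx
        rw [eventually_all_finite hFfin]
        intro y hy
        by_cases hxy : x = y
        · simp [hxy]
        have h1 : ¬ ∀ z ∈ Set.uIcc x y, f z ≤ t := fun h => hxy <|
          hF.injOn hx hy ((sublevelClass_eq_iff ((hFs hy).2.trans hst.le)).2 h)
        push Not at h1
        obtain ⟨z, hz, hzt⟩ := h1
        filter_upwards [Ioo_mem_nhdsGT hzt] with t' ht' h2
        have := (sublevelClass_eq_iff ((hFs hy).2.trans (hst.trans ht'.1).le)).1 h2 z hz
        exact absurd ht'.2 (not_lt.2 this)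
      obtain ⟨x, hxA, hx⟩ := ht
      filter_upwards [(eventually_all_finite hFfin).2 key, Ioo_mem_nhdsGT hx] with t' h1 h2
      rw [sublevelRank, sublevelRank, if_pos ⟨x, hxA, h2.2⟩, if_pos ⟨x, hxA, hx⟩]
      refine le_antisymm (hanti hst h2.1.le) ?_
      have h3 : (sublevelClass f t' '' F).ncard = F.ncard :=
        Set.InjOn.ncard_image fun x hx y hy => h1 x hx y hy
      have h4 : (sublevelClasses f A s t).ncard = F.ncard := by
        rw [sublevelClasses, ← hF.image_eq, hF.injOn.ncard_image]
      rw [h4, ← h3]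
      exact Set.ncard_le_ncard (Set.image_mono hFs) (hfin (hst.trans h2.1))
    · filter_upwards [self_mem_nhdsWithin] with t' ht'
      rw [sublevelRank, sublevelRank, if_neg ht, if_neg]
      rintro ⟨x, hx, hxt⟩
      exact ht ⟨x, hx, lt_trans ht' hxt⟩

theorem ncard_range_eq_of_eq_iff_eq {α β γ : Type*} {u : α → β} {v : α → γ}
    (h : ∀ x y, u x = u y ↔ v x = v y) : (Set.range u).ncard = (Set.range v).ncard := by
  rcases isEmpty_or_nonempty α with hα | ⟨⟨a⟩⟩
  · rw [Set.range_eq_empty, Set.range_eq_empty, Set.ncard_empty, Set.ncard_empty]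
  have : Nonempty γ := ⟨v a⟩
  let g := Function.extend u v fun _ => v a
  have hg : ∀ x, g (u x) = v x := fun x =>
    Function.FactorsThrough.extend_apply (fun x y hxy => (h x y).1 hxy) _ x
  have : Set.range v = g '' Set.range u := by
    rw [← Set.range_comp]
    exact congrArg Set.range (funext fun x => (hg x).symm)
  rw [this, Set.InjOn.ncard_image]
  rintro _ ⟨x, rfl⟩ _ ⟨y, rfl⟩ hxy
  rw [hg, hg] at hxy
  exact (h x y).2 hxy

/-- A path covers the segment between its ends, and that segment stays in `[a, b]`. So components
may be taken in the whole line, which reduces the comparison of different intervals to inclusions of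
sets of classes. -/
theorem joined_sublevel_iff {a b : ℝ} (x y : {x : Set.Icc a b // f x ≤ t}) :
    Joined x y ↔ ∀ z ∈ Set.uIcc (x.1 : ℝ) y.1, f z ≤ t := by
  constructor
  · rintro ⟨γ⟩ z hz
    have hc : Continuous fun τ => ((γ τ).1 : ℝ) :=
      continuous_subtype_val.comp (continuous_subtype_val.comp γ.continuous)
    have hpre := isPreconnected_range hc
    have hz' := hpre.ordConnected.uIcc_subset ⟨0, by simp⟩ ⟨1, by simp⟩ hz
    obtain ⟨τ, rfl⟩ := hz'
    exact (γ τ).2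
  · intro h
    have hmem : ∀ τ : unitInterval, AffineMap.lineMap (x.1 : ℝ) (y.1 : ℝ) (τ : ℝ)
        ∈ Set.uIcc (x.1 : ℝ) y.1 := fun τ => by
      rw [← segment_eq_uIcc, segment_eq_image_lineMap]
      exact ⟨τ, τ.2, rfl⟩
    exact ⟨{
      toFun τ := ⟨⟨AffineMap.lineMap (x.1 : ℝ) (y.1 : ℝ) (τ : ℝ),
        Set.ordConnected_Icc.uIcc_subset x.1.2 y.1.2 (hmem τ)⟩, h _ (hmem τ)⟩
      continuous_toFun := by
        refine Continuous.subtype_mk (Continuous.subtype_mk ?_ _) _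
        exact AffineMap.lineMap_continuous.comp continuous_subtype_val
      source' := by simp
      target' := by simp }⟩

theorem diagram_eq_rankDiagram {k : Type*} [Field k] (f : ℝ → ℝ) (a b : ℝ) :
    diagram k f a b = rankDiagram (sublevelRank f (Set.Icc a b)) := by
  refine moduleDiagram_eq_rankDiagram _ _ fun s t hst => ?_
  by_cases ht : ∃ x ∈ Set.Icc a b, t < f x
  · rw [sublevelRank, if_pos ht]
    obtain ⟨x, hx, hxt⟩ := ht
    refine (rank_truncate_of_pos _ _ hst.le ⟨⟨x, hx⟩, hxt⟩).trans ?_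
    refine (homRank_H0_map _).trans ?_
    have h := ncard_range_eq_of_eq_iff_eq
      (u := fun x : {x : Set.Icc a b // f x ≤ s} =>
        (ZerothHomotopy.mk (⟨x.1, x.2.trans hst.le⟩ : {x : Set.Icc a b // f x ≤ t})))
      (v := fun x => sublevelClass f t x.1) (fun x y => by
        rw [sublevelClass_eq_iff (y.2.trans hst.le)]
        exact Quotient.eq.trans (joined_sublevel_iff _ _))
    refine Eq.trans h ?_
    congr 1
    ext C
    constructor
    · rintro ⟨x, rfl⟩
      exact ⟨x.1, ⟨x.1.2, x.2⟩, rfl⟩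
    · rintro ⟨x, ⟨hx, hxs⟩, rfl⟩
      exact ⟨⟨⟨x, hx⟩, hxs⟩, rfl⟩
  · rw [sublevelRank, if_neg ht]
    refine rank_truncate_of_neg _ _ hst.le ?_
    rintro ⟨x, hx⟩
    exact ht ⟨x, x.2, hx⟩

theorem sublevelClasses_union : sublevelClasses f (A ∪ B) s t
    = sublevelClasses f A s t ∪ sublevelClasses f B s t := by
  rw [sublevelClasses, sublevelClasses, sublevelClasses, ← Set.image_union]
  congr 1
  ext x
  simp [or_and_right]

/-- The rank function is additive if an interval is cut at a point where `f` is maximal. -/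
theorem sublevelRank_Icc_add (hf : Continuous f) {a m b : ℝ} (ham : a ≤ m) (hmb : m ≤ b)
    (hm : ∀ x, f x ≤ f m) (hst : s < t) :
    sublevelRank f (Set.Icc a b) s t
      = sublevelRank f (Set.Icc a m) s t + sublevelRank f (Set.Icc m b) s t := by
  by_cases ht : t < f m
  · rw [sublevelRank, sublevelRank, sublevelRank, if_pos ⟨m, ⟨ham, hmb⟩, ht⟩,
      if_pos ⟨m, ⟨ham, le_rfl⟩, ht⟩, if_pos ⟨m, ⟨le_rfl, hmb⟩, ht⟩,
      ← Set.Icc_union_Icc_eq_Icc ham hmb, sublevelClasses_union]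
    refine Set.ncard_union_eq ?_ (finite_sublevelClasses hf isCompact_Icc hst)
      (finite_sublevelClasses hf isCompact_Icc hst)
    -- A common class would contain `m`, where `f m > t`.
    rw [Set.disjoint_left]
    rintro _ ⟨x, hx, rfl⟩ ⟨y, hy, hyx⟩
    have := (sublevelClass_eq_iff (hx.2.trans hst.le)).1 hyx m
      (Set.mem_uIcc.2 (Or.inr ⟨hx.1.2, hy.1.1⟩))
    exact absurd ht (not_lt.2 this)
  · have h : ∀ A : Set ℝ, ¬ ∃ x ∈ A, t < f x := fun A ⟨x, _, hx⟩ => ht (hx.trans_le (hm x))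
    rw [sublevelRank, sublevelRank, sublevelRank, if_neg (h _), if_neg (h _), if_neg (h _)]

/-- The rank function increases with the set. -/
theorem sublevelRank_le_of_subset (hf : Continuous f) (hB : IsCompact B) (hAB : A ⊆ B)
    (hst : s < t) : sublevelRank f A s t ≤ sublevelRank f B s t := by
  unfold sublevelRank
  split_ifs with h1 h2
  · exact Set.ncard_le_ncard (sublevelClasses_mono hAB le_rfl) (finite_sublevelClasses hf hB hst)
  · obtain ⟨x, hx, hxt⟩ := h1
    exact absurd ⟨x, hAB hx, hxt⟩ h2
  · exact Nat.zero_le _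
  · exact le_rfl

theorem sublevelRank_image_add (f : ℝ → ℝ) {T : ℝ} (hT : Function.Periodic f T) (A : Set ℝ)
    (s t : ℝ) : sublevelRank f ((· + T) '' A) s t = sublevelRank f A s t := by
  have h1 : ∀ x, sublevelClass f t (x + T) = (· + T) '' sublevelClass f t x := by
    intro x
    ext y
    constructor
    · intro hy
      refine ⟨y - T, fun z hz => ?_, sub_add_cancel y T⟩
      rw [← hT z]
      refine hy _ ?_
      have := Set.mem_image_of_mem (· + T) hz
      rwa [Set.image_add_const_uIcc, sub_add_cancel] at this
    · rintro ⟨y, hy, rfl⟩ z hz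
      rw [← Set.image_add_const_uIcc] at hz
      obtain ⟨z, hz, rfl⟩ := hz
      change f (z + T) ≤ t
      rw [hT]
      exact hy z hz
  have h2 : sublevelClasses f ((· + T) '' A) s t
      = Set.image (· + T) '' sublevelClasses f A s t := by
    ext C
    constructor
    · rintro ⟨_, ⟨⟨x, hx, rfl⟩, hxs⟩, rfl⟩
      exact ⟨_, ⟨x, ⟨hx, by simpa only [hT x] using hxs⟩, rfl⟩, (h1 x).symm⟩
    · rintro ⟨_, ⟨x, hx, rfl⟩, rfl⟩
      exact ⟨x + T, ⟨⟨x, hx.1, rfl⟩, (hT x).trans_le hx.2⟩, h1 x⟩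
  have h3 : (∃ x ∈ (· + T) '' A, t < f x) ↔ ∃ x ∈ A, t < f x := by
    rw [Set.exists_mem_image]
    simp only [hT _]
  have h4 := Set.ncard_image_of_injective (sublevelClasses f A s t)
    (Set.image_injective.2 (add_left_injective T))
  by_cases h : ∃ x ∈ A, t < f x
  · rw [sublevelRank, sublevelRank, if_pos (h3.2 h), if_pos h, h2, h4]
  · rw [sublevelRank, sublevelRank, if_neg (mt h3.1 h), if_neg h]

end Persistence

end

/-! ### Total persistence as an integral of ranks. -/

noncomputable section

open Filter Topology MeasureTheory

namespace Persistence

/-- Sums over the plane have an uncountable index set; only countably many points off the diagonal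
carry weight. -/
theorem lintegral_tsum_of_countable {ι α : Type*} [MeasurableSpace α] {μ : Measure α} {S : Set ι}
    (hS : S.Countable) {F : ι → α → ℝ≥0∞} (hF : ∀ x, AEMeasurable (F x) μ)
    (h0 : ∀ x, x ∉ S → ∀ t, F x t = 0) :
    ∫⁻ t, ∑' x, F x t ∂μ = ∑' x, ∫⁻ t, F x t ∂μ := by
  have := hS.to_subtype
  have h1 : ∀ t, ∑' x, F x t = ∑' x : S, F x t := fun t =>
    (tsum_subtype_eq_of_support_subset fun x hx => by
      by_contra h
      exact hx (h0 x h t)).symm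
  have h2 : ∑' x, ∫⁻ t, F x t ∂μ = ∑' x : S, ∫⁻ t, F x t ∂μ :=
    (tsum_subtype_eq_of_support_subset (f := fun x => ∫⁻ t, F x t ∂μ) fun x hx => by
      by_contra h
      exact hx (by simp [h0 x h])).symm
  simp_rw [h1, h2]
  exact lintegral_tsum fun x => hF x

/-- The function `y ^ p` is a superposition of the functions `(y - ε)₊` with `ε > 0`. -/
theorem ofReal_rpow_eq_lintegral {p y : ℝ} (hp : 1 < p) (hy : 0 < y) :
    ENNReal.ofReal y ^ p
      = ∫⁻ ε in Set.Ioi 0, ENNReal.ofReal (y - ε) * ENNReal.ofReal (p * (p - 1) * ε ^ (p - 2)) := by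
  have h1 : ∫⁻ ε in Set.Ioi 0, ENNReal.ofReal (y - ε) * ENNReal.ofReal (p * (p - 1) * ε ^ (p - 2))
      = ∫⁻ ε in Set.Ioc 0 y,
        ENNReal.ofReal (p * (p - 1) * (y * ε ^ (p - 2) - ε ^ (p - 1))) := by
    rw [← Set.Ioc_union_Ioi_eq_Ioi hy.le, lintegral_union measurableSet_Ioi
      (Set.Ioc_disjoint_Ioi le_rfl)]
    rw [setLIntegral_congr_fun (g := fun _ => 0) measurableSet_Ioi, lintegral_zero, add_zero]
    · refine setLIntegral_congr_fun measurableSet_Ioc fun ε hε => ?_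
      rw [← ENNReal.ofReal_mul (by linarith [hε.2])]
      congr 1
      have : ε ^ (p - 1) = ε * ε ^ (p - 2) := by
        rw [show p - 1 = 1 + (p - 2) by ring, Real.rpow_add hε.1, Real.rpow_one]
      rw [this]
      ring
    · intro ε hε
      have : y - ε ≤ 0 := by linarith [show y < ε from hε]
      simp [ENNReal.ofReal_of_nonpos this]
  -- `p > 1` makes the exponent `p - 2` exceed `-1`.
  have hi1 : IntervalIntegrable (fun ε : ℝ => ε ^ (p - 2)) volume 0 y :=
    intervalIntegral.intervalIntegrable_rpow' (by linarith)
  have hi2 : IntervalIntegrable (fun ε : ℝ => ε ^ (p - 1)) volume 0 y :=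
    intervalIntegral.intervalIntegrable_rpow' (by linarith)
  have hi : IntervalIntegrable (fun ε : ℝ => p * (p - 1) * (y * ε ^ (p - 2) - ε ^ (p - 1)))
      volume 0 y := ((hi1.const_mul y).sub hi2).const_mul _
  rw [h1, ← ofReal_integral_eq_lintegral_ofReal
    ((intervalIntegrable_iff_integrableOn_Ioc_of_le hy.le).1 hi),
    ← intervalIntegral.integral_of_le hy.le, intervalIntegral.integral_const_mul,
    intervalIntegral.integral_sub (hi1.const_mul y) hi2, intervalIntegral.integral_const_mul,
    integral_rpow (Or.inl (by linarith)), integral_rpow (Or.inl (by linarith)),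
    ENNReal.ofReal_rpow_of_pos hy]
  · congr 1
    have e1 : p - 2 + 1 = p - 1 := by ring
    have e2 : p - 1 + 1 = p := by ring
    have e3 : y ^ p = y * y ^ (p - 1) := by
      rw [← Real.rpow_one_add' hy.le (by linarith)]
      congr 1
      ring
    rw [e1, e2, Real.zero_rpow (by linarith), Real.zero_rpow (by linarith), e3]
    have : p - 1 ≠ 0 := by linarith
    field_simp
    ring
  · refine (ae_restrict_iff' measurableSet_Ioc).2 (Eventually.of_forall fun ε hε => ?_)
    have : ε ^ (p - 1) = ε * ε ^ (p - 2) := by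
      rw [show p - 1 = 1 + (p - 2) by ring, Real.rpow_add hε.1, Real.rpow_one]
    have h3 : 0 ≤ ε ^ (p - 2) := Real.rpow_nonneg hε.1.le _
    have h4 : y * ε ^ (p - 2) - ε ^ (p - 1) = (y - ε) * ε ^ (p - 2) := by
      rw [this]
      ring
    simp only [Pi.zero_apply]
    rw [h4]
    exact mul_nonneg (mul_nonneg (by linarith) (by linarith))
      (mul_nonneg (by linarith [hε.2]) h3)

/-- The points above the diagonal. -/
def aboveDiagonal (D : PlaneMultiset) : Set (ℝ × ℝ) := {x | x.1 < x.2 ∧ D x ≠ 0}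

/-- The multiplicities of the points above the diagonal. -/
def weight (D : PlaneMultiset) (x : ℝ × ℝ) : ℝ≥0∞ :=
  (aboveDiagonal D).indicator (fun x => (D x : ℝ≥0∞)) x

theorem IsPersistenceDiagram.countable_aboveDiagonal {D : PlaneMultiset}
    (hD : IsPersistenceDiagram D) : (aboveDiagonal D).Countable := by
  have : aboveDiagonal D ⊆ ⋃ q : {q : ℚ × ℚ // q.1 < q.2},
      {x : ℝ × ℝ | x.1 ≤ q.1.1 ∧ (q.1.2 : ℝ) ≤ x.2 ∧ D x ≠ 0} := by
    rintro x ⟨hx, hDx⟩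
    obtain ⟨q₁, h1, h2⟩ := exists_rat_btwn hx
    obtain ⟨q₂, h3, h4⟩ := exists_rat_btwn h2
    exact Set.mem_iUnion.2 ⟨⟨(q₁, q₂), by exact_mod_cast h3⟩, h1.le, h4.le, hDx⟩
  refine (Set.countable_iUnion fun q => ?_).mono this
  exact (hD.finite_quadrant _ _ (by exact_mod_cast q.2)).countable

theorem weight_ne_top {D : PlaneMultiset} (hD : IsPersistenceDiagram D) (x : ℝ × ℝ) :
    weight D x ≠ ⊤ := by
  unfold weight
  by_cases hx : x ∈ aboveDiagonal D
  · rw [Set.indicator_of_mem hx]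
    have := hD.ne_top x.1 x.2 hx.1
    simpa using this
  · simp [hx]

/-- Terms that vanish on and below the diagonal do not see its infinite multiplicities, so `weight`,
which has countable support, can replace the diagram. -/
theorem weight_mul_eq {D : PlaneMultiset} {x : ℝ × ℝ} {c : ℝ≥0∞}
    (hc : x.2 ≤ x.1 → c = 0) : weight D x * c = D x * c := by
  unfold weight
  by_cases hx : x ∈ aboveDiagonal D
  · rw [Set.indicator_of_mem hx]
  · rw [Set.indicator_of_notMem hx]
    by_cases h : x.2 ≤ x.1
    · simp [hc h]
    · have : D x = 0 := by
        by_contra h'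
        exact hx ⟨not_le.1 h, h'⟩
      simp [this]

variable {r r₁ r₂ : ℝ → ℝ → ℕ}

/-- `(d - b - ε)₊` is the length of `[b + ε, d)`, and `t` lies there exactly when `(b, d)` is in the
quadrant counted by `r (t - ε) t`. Summation and integration are then exchanged. -/
theorem IsRankFunction.tsum_weight_sub (hr : IsRankFunction r) {ε : ℝ} (hε : 0 < ε) :
    ∑' x : ℝ × ℝ, weight (rankDiagram r) x * ENNReal.ofReal (x.2 - x.1 - ε)
      = ∫⁻ t, (r (t - ε) t : ℝ≥0∞) := by
  have hD := hr.isPersistenceDiagram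
  have h1 : ∀ t, (r (t - ε) t : ℝ≥0∞) = ∑' x : ℝ × ℝ, weight (rankDiagram r) x *
      (Set.Ico (x.1 + ε) x.2).indicator (fun _ => 1) t := by
    intro t
    rw [← hr.tsum_quadrant (show t - ε < t by linarith)]
    refine tsum_congr fun x => ?_
    rw [weight_mul_eq]
    · by_cases hx : x.1 ≤ t - ε ∧ t < x.2
      · rw [Set.indicator_of_mem (show x ∈ {x : ℝ × ℝ | x.1 ≤ t - ε ∧ t < x.2} from hx),
          Set.indicator_of_mem (show t ∈ Set.Ico (x.1 + ε) x.2 from ⟨by linarith [hx.1], hx.2⟩),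
          mul_one]
      · rw [Set.indicator_of_notMem (show x ∉ {x : ℝ × ℝ | x.1 ≤ t - ε ∧ t < x.2} from hx),
          Set.indicator_of_notMem (show t ∉ Set.Ico (x.1 + ε) x.2 from
            fun h => hx ⟨by linarith [h.1], h.2⟩), mul_zero]
    · intro hx
      exact Set.indicator_of_notMem (fun h => by linarith [h.1, h.2]) _
  simp_rw [h1]
  rw [lintegral_tsum_of_countable hD.countable_aboveDiagonal]
  · refine tsum_congr fun x => ?_
    rw [lintegral_const_mul _ (measurable_const.indicator measurableSet_Ico),
      lintegral_indicator_const measurableSet_Ico, one_mul, Real.volume_Ico]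
    congr 2
    ring
  · exact fun x => ((measurable_const.indicator measurableSet_Ico).const_mul _).aemeasurable
  · intro x hx t
    rw [weight, Set.indicator_of_notMem hx, zero_mul]

/-- The total persistence, before the root is taken, increases with the rank function. -/
theorem IsRankFunction.tsum_rpow_mono (h₁ : IsRankFunction r₁) (h₂ : IsRankFunction r₂)
    (hle : ∀ s t, s < t → r₁ s t ≤ r₂ s t) {p : ℝ} (hp : 1 ≤ p) :
    ∑' x : ℝ × ℝ, (rankDiagram r₁ x : ℝ≥0∞) * ENNReal.ofReal (x.2 - x.1) ^ p
      ≤ ∑' x : ℝ × ℝ, (rankDiagram r₂ x : ℝ≥0∞) * ENNReal.ofReal (x.2 - x.1) ^ p := by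
  have hD₁ := h₁.isPersistenceDiagram
  have hD₂ := h₂.isPersistenceDiagram
  have hw : ∀ D : PlaneMultiset,
      ∑' x : ℝ × ℝ, (D x : ℝ≥0∞) * ENNReal.ofReal (x.2 - x.1) ^ p
        = ∑' x : ℝ × ℝ, weight D x * ENNReal.ofReal (x.2 - x.1) ^ p := fun D =>
    tsum_congr fun x => (weight_mul_eq fun hx => by
      rw [ENNReal.ofReal_of_nonpos (by linarith), ENNReal.zero_rpow_of_pos (by linarith)]).symm
  have hG : ∀ ε, 0 < ε →
      ∑' x : ℝ × ℝ, weight (rankDiagram r₁) x * ENNReal.ofReal (x.2 - x.1 - ε)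
        ≤ ∑' x : ℝ × ℝ, weight (rankDiagram r₂) x * ENNReal.ofReal (x.2 - x.1 - ε) := by
    intro ε hε
    rw [h₁.tsum_weight_sub hε, h₂.tsum_weight_sub hε]
    refine lintegral_mono fun t => ?_
    exact Nat.cast_le.2 (hle (t - ε) t (by linarith))
  rw [hw, hw]
  rcases hp.eq_or_lt with rfl | hp
  -- For `p = 1` the density `p (p - 1) ε ^ (p - 2)` vanishes; instead `ε → 0` in finite partial
  -- sums.
  · simp only [ENNReal.rpow_one]
    rw [ENNReal.tsum_eq_iSup_sum]
    refine iSup_le fun F => ?_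
    have hlim : Tendsto (fun ε : ℝ => ∑ x ∈ F, weight (rankDiagram r₁) x *
        ENNReal.ofReal (x.2 - x.1 - ε)) (𝓝[>] 0)
        (𝓝 (∑ x ∈ F, weight (rankDiagram r₁) x * ENNReal.ofReal (x.2 - x.1))) := by
      refine tendsto_finsetSum _ fun x _ => ?_
      refine ENNReal.Tendsto.const_mul ?_ (Or.inr (weight_ne_top hD₁ x))
      have : Tendsto (fun ε : ℝ => x.2 - x.1 - ε) (𝓝[>] 0) (𝓝 (x.2 - x.1 - 0)) :=
        ((continuous_const.sub continuous_id).tendsto 0).mono_left nhdsWithin_le_nhds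
      rw [sub_zero] at this
      exact ENNReal.tendsto_ofReal this
    refine le_of_tendsto hlim ?_
    filter_upwards [self_mem_nhdsWithin] with ε hε
    refine (ENNReal.sum_le_tsum F).trans ((hG ε hε).trans (ENNReal.tsum_le_tsum fun x => ?_))
    exact mul_le_mul_right (ENNReal.ofReal_le_ofReal (by linarith [show (0 : ℝ) < ε from hε])) _
  · have hint : ∀ {D : PlaneMultiset}, IsPersistenceDiagram D →
        ∑' x : ℝ × ℝ, weight D x * ENNReal.ofReal (x.2 - x.1) ^ p
          = ∫⁻ ε in Set.Ioi 0, (∑' x : ℝ × ℝ, weight D x * ENNReal.ofReal (x.2 - x.1 - ε))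
            * ENNReal.ofReal (p * (p - 1) * ε ^ (p - 2)) := by
      intro D hD
      simp_rw [← ENNReal.tsum_mul_right]
      have hm : ∀ x : ℝ × ℝ, Measurable fun ε : ℝ =>
          ENNReal.ofReal (x.2 - x.1 - ε) * ENNReal.ofReal (p * (p - 1) * ε ^ (p - 2)) := by
        intro x
        fun_prop
      rw [lintegral_tsum_of_countable hD.countable_aboveDiagonal]
      · refine tsum_congr fun x => ?_
        simp_rw [mul_assoc (weight D x)]
        rw [lintegral_const_mul _ (hm x)]
        by_cases hx : x ∈ aboveDiagonal D
        · rw [ofReal_rpow_eq_lintegral hp (sub_pos.2 hx.1)]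
        · simp [weight, hx]
      · intro x
        simp_rw [mul_assoc (weight D x)]
        exact ((hm x).const_mul _).aemeasurable
      · intro x hx t
        simp [weight, hx]
    rw [hint hD₁, hint hD₂]
    refine setLIntegral_mono' measurableSet_Ioi fun ε hε => ?_
    exact mul_le_mul_left (hG ε hε) _

end Persistence

end

/-! ### Cutting at maxima, translating, and comparing the pieces. -/

noncomputable section

namespace Persistence

theorem rankDiagram_congr {r r' : ℝ → ℝ → ℕ} (h : ∀ s t, s < t → r s t = r' s t) :
    rankDiagram r = rankDiagram r' := by
  funext q
  unfold rankDiagram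
  split_ifs with hq hq'
  · refine iInf_congr fun a => iInf_congr fun b => iInf_congr fun c => iInf_congr fun d =>
      iInf_congr fun h1 => iInf_congr fun h2 => iInf_congr fun h3 => iInf_congr fun h4 =>
      iInf_congr fun h5 => ?_
    rw [rankRect, rankRect, h b c h3, h a c ((h1.trans h2).trans h3),
      h b d (h3.trans (h4.trans h5)), h a d ((h1.trans h2).trans (h3.trans (h4.trans h5)))]
  · rfl
  · rfl

variable {k : Type*} [Field k] {f : ℝ → ℝ}

theorem isPersistenceDiagram_diagram (hf : Continuous f) (a b : ℝ) :
    IsPersistenceDiagram (diagram k f a b) := by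
  rw [diagram_eq_rankDiagram]
  exact (isRankFunction_sublevelRank hf isCompact_Icc).isPersistenceDiagram

theorem diagram_add (hf : Continuous f) {a m b : ℝ} (ham : a ≤ m) (hmb : m ≤ b)
    (hm : ∀ x, f x ≤ f m) : diagram k f a b = diagram k f a m + diagram k f m b := by
  rw [diagram_eq_rankDiagram, diagram_eq_rankDiagram, diagram_eq_rankDiagram,
    ← (isRankFunction_sublevelRank hf isCompact_Icc).rankDiagram_add
      (isRankFunction_sublevelRank hf isCompact_Icc)]
  exact rankDiagram_congr fun s t hst => sublevelRank_Icc_add hf ham hmb hm hst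

theorem diagram_add_period {T : ℝ} (hT : Function.Periodic f T) (a b : ℝ) :
    diagram k f (a + T) (b + T) = diagram k f a b := by
  rw [diagram_eq_rankDiagram, diagram_eq_rankDiagram]
  refine rankDiagram_congr fun s t _ => ?_
  rw [← sublevelRank_image_add f hT (Set.Icc a b), Set.image_add_const_Icc]

theorem diagram_eq_nsmul_add (hf : Continuous f) (hper : Function.Periodic f 1) {c : ℝ}
    (hc : ∀ x, f x ≤ f c) (n : ℕ) {b : ℝ} (hb : c + n ≤ b) :
    diagram k f c b = n • diagram k f c (c + 1) + diagram k f (c + n) b := by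
  induction n with
  | zero => simp
  | succ n ih =>
    push_cast at hb
    have hn : Function.Periodic f n := by simpa using hper.nat_mul n
    have hn' : f (c + (n + 1)) = f c := by rw [← add_assoc, hper, hn]
    rw [ih (by linarith), diagram_add (m := c + (n + 1)) hf (by linarith) hb
      (fun x => hn'.symm ▸ hc x), ← add_assoc c (n : ℝ) 1, add_right_comm c (n : ℝ) 1,
      diagram_add_period hn, succ_nsmul, Nat.cast_succ, ← add_assoc c (n : ℝ) 1,
      add_right_comm c (n : ℝ) 1, add_assoc (n • diagram k f c (c + 1))]

/-- The sum `∑ (d - b) ^ p` of which the total `p`-persistence is a root. -/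
def persSum (p : ℝ) (D : PlaneMultiset) : ℝ≥0∞ :=
  ∑' x : ℝ × ℝ, (D x : ℝ≥0∞) * ENNReal.ofReal (x.2 - x.1) ^ p

theorem persSum_add (p : ℝ) (D₁ D₂ : PlaneMultiset) :
    persSum p (D₁ + D₂) = persSum p D₁ + persSum p D₂ := by
  unfold persSum
  rw [← ENNReal.tsum_add]
  refine tsum_congr fun x => ?_
  rw [Pi.add_apply, ENat.toENNReal_add, add_mul]

theorem pers_le_two_mul {p : ℝ} (hp : 0 < p) {D D₁ : PlaneMultiset}
    (h : persSum p D ≤ 2 ^ p * persSum p D₁) : pers p D ≤ 2 * pers p D₁ := by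
  have hp' : 0 ≤ 1 / p := by positivity
  refine (ENNReal.rpow_le_rpow h hp').trans (le_of_eq ?_)
  rw [ENNReal.mul_rpow_of_nonneg _ _ hp', ← ENNReal.rpow_mul, mul_one_div_cancel hp.ne',
    ENNReal.rpow_one]
  rfl

theorem persSum_diagram_mono (hf : Continuous f) {a b a' b' p : ℝ} (hp : 1 ≤ p) (ha : a' ≤ a)
    (hb : b ≤ b') : persSum p (diagram k f a b) ≤ persSum p (diagram k f a' b') := by
  rw [diagram_eq_rankDiagram, diagram_eq_rankDiagram]
  exact (isRankFunction_sublevelRank hf isCompact_Icc).tsum_rpow_mono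
    (isRankFunction_sublevelRank hf isCompact_Icc)
    (fun s t hst => sublevelRank_le_of_subset hf isCompact_Icc (Set.Icc_subset_Icc ha hb) hst) hp

theorem exists_isLeast_isMax (hf : Continuous f) (hper : Function.Periodic f 1) :
    ∃ c : ℝ, IsLeast {x : ℝ | x ∈ Set.Icc (0 : ℝ) 1 ∧ ∀ y, f y ≤ f x} c := by
  refine IsCompact.exists_isLeast ?_ ?_
  · refine isCompact_Icc.inter_right (t := {x | ∀ y, f y ≤ f x}) ?_
    rw [Set.ofPred_forall]
    exact isClosed_iInter fun y => isClosed_le continuous_const hf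
  · obtain ⟨x, hx, hmax⟩ := isCompact_Icc.exists_isMaxOn
      (Set.nonempty_Icc.2 (zero_le_one (α := ℝ))) hf.continuousOn
    refine ⟨x, hx, fun y => ?_⟩
    obtain ⟨z, hz, hyz⟩ := hper.exists_mem_Ico₀ one_pos y
    rw [hyz]
    exact hmax (Set.Ico_subset_Icc_self hz)

end Persistence

end

theorem mainTheorem4 {k : Type*} [Field k] (φ : ℝ → ℝ) (hφ : Continuous φ)
    (hper : Function.Periodic φ 1) :
    ∃ c : ℝ, IsLeast {x : ℝ | x ∈ Set.Icc (0 : ℝ) 1 ∧ ∀ y, φ y ≤ φ x} c ∧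
      ∀ R : ℝ, 1 < R →
        (∃ D' : Persistence.PlaneMultiset, Persistence.IsPersistenceDiagram D' ∧
          Persistence.diagram k φ 0 R = ⌊R - 1⌋₊ • Persistence.diagram k φ c (c + 1) + D' ∧
          ∀ p : ℝ, 3 ≤ (2 : ℝ) ^ p →
            Persistence.pers p D' ≤ 2 * Persistence.pers p (Persistence.diagram k φ c (c + 1))) ∧
        (∃ D'' : Persistence.PlaneMultiset, Persistence.IsPersistenceDiagram D'' ∧
          Persistence.diagram k φ 0 R = ⌊R - c⌋₊ • Persistence.diagram k φ c (c + 1) + D'' ∧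
          ∀ p : ℝ, 1 ≤ p →
            Persistence.pers p D'' ≤
              2 * Persistence.pers p (Persistence.diagram k φ c (c + 1))) := by
  obtain ⟨c, hc⟩ := Persistence.exists_isLeast_isMax hφ hper
  refine ⟨c, hc, fun R hR => ?_⟩
  obtain ⟨⟨hc0, hc1⟩, hmax⟩ := hc.1
  set N := ⌊R - c⌋₊ with hN
  set D₁ := Persistence.diagram k φ c (c + 1) with hD₁
  have hNle : (N : ℝ) ≤ R - c := Nat.floor_le (by linarith)
  have hNlt : R - c < N + 1 := Nat.lt_floor_add_one _
  have hperN : Function.Periodic φ N := by simpa using hper.nat_mul N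
  let A := Persistence.diagram k φ 0 c
  let B := Persistence.diagram k φ (c + N) R
  have hdiag : Persistence.IsPersistenceDiagram (A + B) :=
    (Persistence.isPersistenceDiagram_diagram hφ _ _).add
      (Persistence.isPersistenceDiagram_diagram hφ _ _)
  have heq : Persistence.diagram k φ 0 R = N • D₁ + (A + B) := by
    rw [Persistence.diagram_add hφ hc0 (by linarith : c ≤ R) hmax,
      Persistence.diagram_eq_nsmul_add hφ hper hmax N (by linarith : c + N ≤ R)]
    exact add_left_comm _ _ _
  have hA : ∀ p : ℝ, 1 ≤ p → Persistence.persSum p A ≤ Persistence.persSum p D₁ := by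
    intro p hp
    -- Translated by one period, `[0, c]` becomes `[1, c + 1]`, inside `[c, c + 1]` because `c ≤ 1`.
    rw [show A = Persistence.diagram k φ (0 + 1) (c + 1) from
      (Persistence.diagram_add_period hper 0 c).symm]
    exact Persistence.persSum_diagram_mono hφ hp (by linarith) le_rfl
  have hB : ∀ p : ℝ, 1 ≤ p → Persistence.persSum p B ≤ Persistence.persSum p D₁ := by
    intro p hp
    -- Translated back by `N`, the last piece is `[c, R - N]` with `R - N < c + 1`.
    have : B = Persistence.diagram k φ c (R - N) := by
      rw [← Persistence.diagram_add_period hperN, sub_add_cancel]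
    rw [this]
    exact Persistence.persSum_diagram_mono hφ hp le_rfl (by linarith)
  have hAB : ∀ p : ℝ, 1 ≤ p →
      Persistence.persSum p (A + B) ≤ 2 * Persistence.persSum p D₁ := by
    intro p hp
    rw [Persistence.persSum_add, two_mul]
    exact add_le_add (hA p hp) (hB p hp)
  have hpers : ∀ p : ℝ, 1 ≤ p →
      Persistence.pers p (A + B) ≤ 2 * Persistence.pers p D₁ := by
    intro p hp
    refine Persistence.pers_le_two_mul (by linarith) ((hAB p hp).trans ?_)
    gcongr
    simpa using ENNReal.rpow_le_rpow_of_exponent_le (x := 2) (by norm_num) hp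
  have hp1 : ∀ p : ℝ, 3 ≤ (2 : ℝ) ^ p → 1 ≤ p := by
    intro p hp
    by_contra! h
    have := Real.rpow_lt_rpow_of_exponent_lt (x := 2) (by norm_num) h
    rw [Real.rpow_one] at this
    linarith
  refine ⟨?_, A + B, hdiag, heq, hpers⟩
  -- Since `0 ≤ c ≤ 1`, the two floors differ by at most one; if they differ, the spare copy of `D₁`
  -- moves into the remainder.
  have h1 : ⌊R - 1⌋₊ ≤ N := Nat.floor_le_floor (by linarith)
  have h2 : N ≤ ⌊R - 1⌋₊ + 1 := by
    rw [← Nat.floor_add_one (by linarith)]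
    exact Nat.floor_le_floor (by linarith)
  rcases h1.eq_or_lt with h | h
  · exact ⟨A + B, hdiag, by rw [h, heq], fun p hp => hpers p (hp1 p hp)⟩
  · refine ⟨D₁ + (A + B), (Persistence.isPersistenceDiagram_diagram hφ _ _).add hdiag, ?_, ?_⟩
    · rw [heq, show N = ⌊R - 1⌋₊ + 1 by lia, succ_nsmul, add_assoc]
    · intro p hp
      have hp' := hp1 p hp
      refine Persistence.pers_le_two_mul (by linarith) ?_
      have h3 : (3 : ℝ≥0∞) ≤ 2 ^ p := by
        have := ENNReal.ofReal_le_ofReal hp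
        rw [← ENNReal.ofReal_rpow_of_pos two_pos] at this
        simpa using this
      calc Persistence.persSum p (D₁ + (A + B))
          ≤ Persistence.persSum p D₁ + 2 * Persistence.persSum p D₁ := by
            rw [Persistence.persSum_add]
            gcongr
            exact hAB p hp'
        _ = 3 * Persistence.persSum p D₁ := by ring
        _ ≤ _ := by gcongr
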